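/- **Setting.** Fix $n\in\mathbb N$ and $\kappa\ge 0$. Let $\mathcal X$ be a data space with a measurable function $d:\mathcal X\times\mathcal X\to\mathbb R$ with $d(x,x)=0$ for all $x$ (for instance a metric), let $\mathcal Y$ be a label space and $\ell:\mathcal Y\times\mathcal Y\to[0,1]$ a measurable loss. A problem instance has $n$ nodes, each with a data point in $\mathcal X$; the nodes are split into labeled nodes $L$ and unlabeled nodes $U$, and $\tau$ denotes the true labeling. For a threshold $r$, the threshold graph $G(r)$ on the nodes has weights $w(u,v)=\mathbb I[d(u,v)\le r]$. Let $A$ be any (measurable) graph labeling algorithm: from the weights of the graph on the nodes, the data points and the labels of the nodes in $L$ it computes a label $A_{G(r),L,U}(u)$ for every node $u$. The (total) loss of an instance is $\bar l(r)=\sum_{u\in U}\ell(A_{G(r),L,U}(u),\tau(u))$, and its average loss is $\bar l(r)/|U|$ (which is $0$ if $U=\emptyset$). Let $(L_1,U_1,\tau_1),(L_2,U_2,\tau_2),\dots$ be random instances whose losses $\bar l_1,\bar l_2,\dots$ are independent random functions of $r$ (not necessarily identically distributed), and suppose that for every $t$ and every two different nodes $u\neq v$ of the $t$-th instance the distance $d(u,v)$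 has a $\kappa$-bounded distribution, i.e. has a density with respect to Lebesgue measure that is at most $\kappa$. Let $l_t(r)=\bar l_t(r)/|U_t|$ denote the average losses. **Exponential forecaster (Algorithm 1).** Given an interval $C=[a,b]$ with $0\le a<b$ and a step size $\lambda\in(0,1]$: put $w_1\equiv 1$; in round $t$ sample $\rho_t\in C$ from the density $w_t/\int_C w_t$, using fresh randomness, then observe $l_t$ and set $w_{t+1}(\rho)=e^{\lambda(1-l_t(\rho))}w_t(\rho)$. **Theorem.** Under these assumptions: 1. For every instance, $\bar l$ is a piecewise constant function of $r$ with breakpoints at distances between nodes: if $r\le r'$ and no distance $d(u,v)$ between two nodes lies in $(r,r']$, then $\bar l(r)=\bar l(r')$, and $\bar l$ is continuous at every $r$ that is not of the form $d(u,v)$. On $[0,\infty)$ the same holds with only the distances $d(u,v)$ between different nodes $u\ne v$. 2. The sequence is $\tfrac12$-dispersed on $[0,\infty)$: there are constants $K,q$ that depend only on $n$ and $\kappa$ such that for every Lipschitz constant $L\ge 0$, all $T\ge1$ and all $\epsilon\ge T^{-1/2}$, $$\mathbb E\Big[\max_{\rho,\rho'\ge 0,\ |\rho-\rho'|\le\epsilon}\big|\{t\in[T]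 : \bar l_t(\rho)-\bar l_t(\rho')>L|\rho-\rho'|\}\big|\Big]\le K\,\epsilon T\,(1+\log T)^q ,$$ and the same holds for the average losses $l_t$. 3. For every interval $C=[a,b]$ with $0\le a<b$ there are constants $K',q'$ and step sizes $\lambda=\lambda(T)\in(0,1]$ that depend only on $n,\kappa,a,b$ (and $\lambda$ on $T$) such that for all $T\ge1$ the thresholds $\rho_1,\dots,\rho_T$ chosen by the exponential forecaster on $C$ with step size $\lambda(T)$ satisfy $$\mathbb E\Big[\sum_{t=1}^T l_t(\rho_t)-\min_{\rho\in C}\sum_{t=1}^T l_t(\rho)\Big]\le K'\sqrt T\,(1+\log T)^{q'} .$$ If moreover all the $U_t$ have the same cardinality, the same bound holds with the total losses $\bar l_t$ in place of the average losses $l_t$. -/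

import Mathlib

open MeasureTheory ProbabilityTheory Set
open scoped ENNReal NNReal

noncomputable section

namespace GraphSSL

/-- A semi-supervised problem instance with `n` nodes. Each node carries its data point, a flag which
is `true` exactly when the node is unlabeled, and its true label (for an unlabeled node this is the
target label, for a labeled node it is the label that is revealed). -/
abbrev SSLInstance (n : ℕ) (X Y : Type*) : Type _ := Fin n → X × Bool × Y

variable {n : ℕ} {X Y : Type*}

/-- The data points of the nodes. -/
def points (I : SSLInstance n X Y) : Fin n → X := fun i => (I i).1

/-- The target labeling. -/
def target (I : SSLInstance n X Y) : Fin n → Y := fun i => (I i).2.2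

/-- The set `U` of unlabeled nodes. -/
def unlabeled (I : SSLInstance n X Y) : Finset (Fin n) :=
  Finset.univ.filter fun i => (I i).2.1 = true

/-- The labels a labeling algorithm gets to see: `none` on the unlabeled nodes. -/
def visibleLabels (I : SSLInstance n X Y) : Fin n → Option Y :=
  fun i => if (I i).2.1 = true then none else some (I i).2.2

/-- The threshold kernel `w(x, y) = 𝕀[d(x, y) ≤ r]`. -/
def thresholdKernel (d : X → X → ℝ) (r : ℝ) (x y : X) : ℝ :=
  if d x y ≤ r then 1 else 0

/-- The edge weights of the threshold graph `G(r)` on the nodes of an instance. -/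
def thresholdGraph (d : X → X → ℝ) (r : ℝ) (I : SSLInstance n X Y) : Fin n → Fin n → ℝ :=
  fun i j => thresholdKernel d r (points I i) (points I j)

/-- A graph labeling algorithm: from the edge weights, the data points and the visible labels it
computes a label for every node. -/
abbrev LabelingAlgorithm (n : ℕ) (X Y : Type*) : Type _ :=
  (Fin n → Fin n → ℝ) → (Fin n → X) → (Fin n → Option Y) → Fin n → Y

/-- The loss `∑_{u ∈ U} ℓ(A_{G(r),L,U}(u), τ(u))` of the threshold graph `G(r)` labeled by `A`. -/
def loss (d : X → X → ℝ) (A : LabelingAlgorithm n X Y) (ℓ : Y → Y → ℝ)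
    (I : SSLInstance n X Y) (r : ℝ) : ℝ :=
  ∑ u ∈ unlabeled I,
    ℓ (A (thresholdGraph d r I) (points I) (visibleLabels I) u) (target I u)

/-- The average loss over the unlabeled nodes. -/
def avgLoss (d : X → X → ℝ) (A : LabelingAlgorithm n X Y) (ℓ : Y → Y → ℝ)
    (I : SSLInstance n X Y) (r : ℝ) : ℝ :=
  loss d A ℓ I r / ((unlabeled I).card : ℝ)

/-- On `C`, the function `f` is piecewise constant with all breakpoints in `S`: its value does not
change from `r` to `r'` unless there is a breakpoint in `(r, r']`, and all its discontinuities
(relative to `C`) are in `S`. -/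
def PiecewiseConstantOn (f : ℝ → ℝ) (C S : Set ℝ) : Prop :=
  S.Finite ∧
  (∀ r ∈ C, ∀ r' ∈ C, r ≤ r' → Disjoint (Ioc r r') S → f r = f r') ∧
  ∀ r ∈ C, ¬ ContinuousWithinAt f C r → r ∈ S

/-- A distribution on `ℝ` is `κ`-bounded if it has a (Lebesgue) density which is at most `κ`. -/
def KBounded (κ : ℝ≥0) (ν : Measure ℝ) : Prop :=
  ∃ f : ℝ → ℝ≥0∞, Measurable f ∧ (∀ x, f x ≤ κ) ∧ ν = volume.withDensity f

/-- The number of `t < T` for which `l_t(ρ) - l_t(ρ') > L |ρ - ρ'|`. -/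
def lipschitzFailures (l : ℕ → ℝ → ℝ) (L : ℝ) (T : ℕ) (ρ ρ' : ℝ) : ℕ :=
  {t : ℕ | t < T ∧ L * |ρ - ρ'| < l t ρ - l t ρ'}.ncard

/-- The random sequence `l` is `β`-dispersed on the domain `C` for the Lipschitz constant `L`, where
the soft-O bound `Õ(ε T)` is `K ε T (1 + log T) ^ q`. -/
def DispersedWith {Ω : Type*} [MeasurableSpace Ω] (μ : Measure Ω) (l : ℕ → Ω → ℝ → ℝ) (C : Set ℝ)
    (β L K : ℝ) (q : ℕ) : Prop :=
  ∀ T : ℕ, 1 ≤ T → ∀ ε : ℝ, (T : ℝ) ^ (-β) ≤ ε →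
    ∫⁻ ω, (⨆ ρ ∈ C, ⨆ ρ' ∈ C, ⨆ _ : |ρ - ρ'| ≤ ε,
        (lipschitzFailures (fun t => l t ω) L T ρ ρ' : ℝ≥0∞)) ∂μ
      ≤ ENNReal.ofReal (K * (ε * T) * (1 + Real.log T) ^ q)

/-- The weights of the exponential forecaster with step size `lam` run on the losses `l`: they start
as `1`, and after each round they are multiplied by `exp (lam * u_t)` with utility `u_t = 1 - l_t`. -/
def expWeight (lam : ℝ) (l : ℕ → ℝ → ℝ) : ℕ → ℝ → ℝ
  | 0, _ => 1
  | t + 1, r => Real.exp (lam * (1 - l t r)) * expWeight lam l t r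

/-- The distribution from which the forecaster samples its parameter in round `t`: it lives on the
domain `C` and its density is `w_t / ∫_C w_t`. -/
def samplingDist (C : Set ℝ) (lam : ℝ) (l : ℕ → ℝ → ℝ) (t : ℕ) : Measure ℝ :=
  (volume.restrict C).withDensity fun r =>
    ENNReal.ofReal (expWeight lam l t r / ∫ s in C, expWeight lam l t s)

/-- The joint law of the parameters that the forecaster outputs in the first `T` rounds, for a given
sequence of losses (its draws in different rounds use fresh randomness). -/
def runLaw (C : Set ℝ) (lam : ℝ) (l : ℕ → ℝ → ℝ) (T : ℕ) : Measure (Fin T → ℝ) :=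
  Measure.pi fun t => samplingDist C lam l t

/-- The regret, on the losses `l`, of the parameters `ρ` relative to the best fixed parameter in `C`. -/
def regret (C : Set ℝ) (l : ℕ → ℝ → ℝ) (T : ℕ) (ρ : Fin T → ℝ) : ℝ :=
  ∑ t : Fin T, l t (ρ t) - ⨅ r : C, ∑ t : Fin T, l t r

/-- The expected regret over `T` rounds, measured by the losses `m`, of the forecaster run on the
losses `l` is at most `B`. The expectation is over the random losses and the forecaster's sampling,
and it exists. -/
def ExpectedRegretLE {Ω : Type*} [MeasurableSpace Ω] (μ : Measure Ω) (C : Set ℝ) (lam : ℝ)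
    (l m : ℕ → Ω → ℝ → ℝ) (T : ℕ) (B : ℝ) : Prop :=
  (∀ ω, IsProbabilityMeasure (runLaw C lam (fun t => l t ω) T)) ∧
  (∀ ω, Integrable (regret C (fun t => m t ω) T) (runLaw C lam (fun t => l t ω) T)) ∧
  Integrable
    (fun ω => ∫ ρ, regret C (fun t => m t ω) T ρ ∂(runLaw C lam (fun t => l t ω) T)) μ ∧
  ∫ ω, ∫ ρ, regret C (fun t => m t ω) T ρ ∂(runLaw C lam (fun t => l t ω) T) ∂μ ≤ B

end GraphSSL

end

noncomputable section

namespace GraphSSL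

variable {n : ℕ} {X Y : Type*}

/-! ### Piecewise constancy, range and measurability of the losses -/

section

/-! The loss sees `r` only through the comparisons `d(u,v) ≤ r`, so it can change only when `r`
passes a distance. For `r ≥ 0` the diagonal comparisons are always true, which leaves the distances
between different nodes.

Dispersion: two points of `[0, ∞)` at distance at most `ε` share one of the windows `[kε, (k+2)ε)`.
As `L ≥ 0`, a failure in round `t` requires the `t`-th loss to be nonconstant on that window, hence
a distance of distinct nodes in it. These events are independent over `t`, have probability at most
`2n²κε`, and for fixed `t` their probabilities sum over `k` to at most `2n²`. There are infinitely
many windows, so a plain union bound is useless. Instead `lintegral_iSup_count_le` bounds the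
expected maximal count `N_k` through `E[exp N_k - 1]`, which is proportional to the expected count
in window `k` and therefore summable over `k`. The result is `O(εT + log T)`, with constants
depending on `n` and `κ` only (`dispersedWith_of_loss`).

Regret: `sum_integral_samplingDist_le` compares two bounds on the total weight after `T` rounds.
From above, each round multiplies it by at most `exp(λ(1 - expected loss) + λ²)`. From below, an
interval of length `h` around any comparator keeps a weight close to that of the comparator, up to
the number `F` of rounds whose loss increases within distance `h`. Taking logarithms gives regret at
most `F + log((b-a)/h)/λ + λT`. With `λ = 1/√T`, `h` of order `1/√T`, and dispersion for `L = 0`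
controlling the expectation of `F`, every term is `√T` up to logarithms. -/

lemma thresholdGraph_congr {d : X → X → ℝ} {r r' : ℝ} {I : SSLInstance n X Y}
    (h : ∀ i j, d (points I i) (points I j) ≤ r ↔ d (points I i) (points I j) ≤ r') :
    thresholdGraph d r I = thresholdGraph d r' I := by
  funext i j
  simp only [thresholdGraph, thresholdKernel, h i j]

lemma loss_congr {d : X → X → ℝ} (A : LabelingAlgorithm n X Y) (ℓ : Y → Y → ℝ) {r r' : ℝ}
    {I : SSLInstance n X Y}
    (h : ∀ i j, d (points I i) (points I j) ≤ r ↔ d (points I i) (points I j) ≤ r') :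
    loss d A ℓ I r = loss d A ℓ I r' := by
  simp only [loss, thresholdGraph_congr h]

/-- A function that only changes when it passes a point of a finite set is constant on a
right neighbourhood of each point. -/
lemma exists_right_const {f : ℝ → ℝ} {C S : Set ℝ} (hS : S.Finite)
    (h : ∀ r ∈ C, ∀ r' ∈ C, r ≤ r' → Disjoint (Ioc r r') S → f r = f r') {r : ℝ} (hr : r ∈ C) :
    ∃ δ > 0, ∀ r' ∈ C, r ≤ r' → r' < r + δ → f r' = f r := by
  -- `r` itself may be a breakpoint: `Ioc r r'` omits it, so only the other points of `S` must be
  -- avoided.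
  have hcl : IsClosed (S \ {r}) := (hS.subset sdiff_subset).isClosed
  obtain ⟨δ, hδ, hball⟩ := Metric.isOpen_iff.1 hcl.isOpen_compl r (by simp)
  refine ⟨δ, hδ, fun r' hr' h1 h2 => (h r hr r' hr' h1 ?_).symm⟩
  rw [Set.disjoint_left]
  rintro x ⟨hx1, hx2⟩ hxS
  refine hball (a := x) ?_ ⟨hxS, by simpa using hx1.ne'⟩
  rw [Metric.mem_ball, Real.dist_eq, abs_lt]
  constructor <;> linarith

/-- A point outside the finite, hence closed, set `S` has a ball that misses `S`, and `f` is
constant on the part of that ball in `C`. -/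
lemma piecewiseConstantOn_of_finite {f : ℝ → ℝ} {C S : Set ℝ} (hS : S.Finite)
    (h : ∀ r ∈ C, ∀ r' ∈ C, r ≤ r' → Disjoint (Ioc r r') S → f r = f r') :
    PiecewiseConstantOn f C S := by
  refine ⟨hS, h, fun r hr hcont => ?_⟩
  by_contra hrS
  obtain ⟨δ, hδ, hball⟩ := Metric.isOpen_iff.1 hS.isClosed.isOpen_compl r hrS
  refine hcont ((continuousWithinAt_const (b := f r)).congr_of_eventuallyEq ?_ rfl)
  filter_upwards [self_mem_nhdsWithin, nhdsWithin_le_nhds (Metric.ball_mem_nhds r hδ)]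
    with r' hr' hb
  rw [Metric.mem_ball, Real.dist_eq, abs_lt] at hb
  have key : ∀ x, min r r' < x → x ≤ max r r' → x ∉ S := by
    intro x h1 h2
    refine hball ?_
    rw [Metric.mem_ball, Real.dist_eq, abs_lt]
    rcases le_total r r' with hle | hle
    · rw [min_eq_left hle] at h1; rw [max_eq_right hle] at h2
      constructor <;> linarith
    · rw [min_eq_right hle] at h1; rw [max_eq_left hle] at h2
      constructor <;> linarith
  rcases le_total r r' with hle | hle
  · refine (h r hr r' hr' hle (Set.disjoint_left.2 fun x hx => key x ?_ ?_)).symm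
    · rw [min_eq_left hle]; exact hx.1
    · rw [max_eq_right hle]; exact hx.2
  · refine h r' hr' r hr hle (Set.disjoint_left.2 fun x hx => key x ?_ ?_)
    · rw [min_eq_right hle]; exact hx.1
    · rw [max_eq_left hle]; exact hx.2

lemma le_iff_le_of_not_mem_Ioc {x r r' : ℝ} (h : r ≤ r') (hx : x ∉ Ioc r r') :
    x ≤ r ↔ x ≤ r' :=
  ⟨fun h1 => h1.trans h, fun h1 => not_lt.1 fun h2 => hx ⟨h2, h1⟩⟩

lemma loss_piecewiseConstantOn_univ (d : X → X → ℝ) (A : LabelingAlgorithm n X Y)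
    (ℓ : Y → Y → ℝ) (I : SSLInstance n X Y) :
    PiecewiseConstantOn (loss d A ℓ I) univ
      {r | ∃ i j, r = d (points I i) (points I j)} := by
  refine piecewiseConstantOn_of_finite ?_ fun r _ r' _ hle hdis => loss_congr A ℓ fun i j =>
    le_iff_le_of_not_mem_Ioc hle fun hx => Set.disjoint_left.1 hdis hx ⟨i, j, rfl⟩
  refine (Set.finite_range fun p : Fin n × Fin n => d (points I p.1) (points I p.2)).subset ?_
  rintro r ⟨i, j, rfl⟩
  exact ⟨(i, j), rfl⟩

lemma loss_piecewiseConstantOn_Ici {d : X → X → ℝ} (hd : ∀ x, d x x = 0)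
    (A : LabelingAlgorithm n X Y) (ℓ : Y → Y → ℝ) (I : SSLInstance n X Y) :
    PiecewiseConstantOn (loss d A ℓ I) (Ici 0)
      {r | ∃ i j, i ≠ j ∧ r = d (points I i) (points I j)} := by
  refine piecewiseConstantOn_of_finite ?_ fun r hr r' hr' hle hdis => loss_congr A ℓ fun i j => ?_
  · refine (Set.finite_range fun p : Fin n × Fin n => d (points I p.1) (points I p.2)).subset ?_
    rintro r ⟨i, j, -, rfl⟩
    exact ⟨(i, j), rfl⟩
  · by_cases hij : i = j
    · subst hij
      rw [hd]
      exact iff_of_true hr hr'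
    · exact le_iff_le_of_not_mem_Ioc hle fun hx => Set.disjoint_left.1 hdis hx ⟨i, j, hij, rfl⟩

lemma loss_mem_Icc (d : X → X → ℝ) (A : LabelingAlgorithm n X Y) {ℓ : Y → Y → ℝ}
    (hℓ : ∀ y y', ℓ y y' ∈ Icc (0 : ℝ) 1) (I : SSLInstance n X Y) (r : ℝ) :
    loss d A ℓ I r ∈ Icc (0 : ℝ) (unlabeled I).card := by
  refine ⟨Finset.sum_nonneg fun u _ => (hℓ _ _).1, ?_⟩
  refine (Finset.sum_le_card_nsmul _ _ 1 fun u _ => (hℓ _ _).2).trans ?_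
  simp

lemma avgLoss_mem_Icc (d : X → X → ℝ) (A : LabelingAlgorithm n X Y) {ℓ : Y → Y → ℝ}
    (hℓ : ∀ y y', ℓ y y' ∈ Icc (0 : ℝ) 1) (I : SSLInstance n X Y) (r : ℝ) :
    avgLoss d A ℓ I r ∈ Icc (0 : ℝ) 1 :=
  ⟨div_nonneg (loss_mem_Icc d A hℓ I r).1 (Nat.cast_nonneg _),
    div_le_one_of_le₀ (loss_mem_Icc d A hℓ I r).2 (Nat.cast_nonneg _)⟩

lemma loss_eq_card_mul_avgLoss (d : X → X → ℝ) (A : LabelingAlgorithm n X Y) (ℓ : Y → Y → ℝ)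
    (I : SSLInstance n X Y) (r : ℝ) :
    loss d A ℓ I r = (unlabeled I).card * avgLoss d A ℓ I r := by
  unfold avgLoss
  by_cases h : (unlabeled I).card = 0
  · have : unlabeled I = ∅ := Finset.card_eq_zero.1 h
    simp [loss, this]
  · have : ((unlabeled I).card : ℝ) ≠ 0 := by exact_mod_cast h
    field_simp

variable [MeasurableSpace X] [MeasurableSpace Y]

/-- The algorithm is measurable only for each fixed weight matrix. Threshold graphs take finitely
many values, so the loss factors through a Boolean matrix and the instance, and measurability can be
checked one matrix at a time. -/
lemma measurable_loss {d : X → X → ℝ} {A : LabelingAlgorithm n X Y} {ℓ : Y → Y → ℝ}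
    (hd : Measurable (Function.uncurry d)) (hℓ : Measurable (Function.uncurry ℓ))
    (hA : ∀ w u, Measurable fun J : SSLInstance n X Y => A w (points J) (visibleLabels J) u) :
    Measurable fun p : SSLInstance n X Y × ℝ => loss d A ℓ p.1 p.2 := by
  let G : (Fin n → Fin n → Bool) → Fin n → Fin n → ℝ := fun g i j => if g i j then 1 else 0
  let code : SSLInstance n X Y × ℝ → (Fin n → Fin n → Bool) := fun p i j =>
    decide (d (points p.1 i) (points p.1 j) ≤ p.2)
  let F : (Fin n → Fin n → Bool) × SSLInstance n X Y → ℝ := fun q =>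
    ∑ u, if (q.2 u).2.1 = true then
      ℓ (A (G q.1) (points q.2) (visibleLabels q.2) u) (target q.2 u) else 0
  have hF : Measurable F := by
    refine measurable_from_prod_countable_right fun g => ?_
    refine Finset.measurable_sum _ fun u _ => ?_
    refine Measurable.ite ?_ ?_ measurable_const
    · exact measurableSet_eq_fun (by fun_prop) measurable_const
    · have ht : Measurable fun J : SSLInstance n X Y => target J u := by
        unfold target; fun_prop
      exact hℓ.comp ((hA (G g) u).prodMk ht)
  have hcode : Measurable code := by
    refine measurable_pi_lambda _ fun i => measurable_pi_lambda _ fun j => ?_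
    have hp : ∀ i, Measurable fun p : SSLInstance n X Y × ℝ => points p.1 i := fun i => by
      unfold points; fun_prop
    have h1 : Measurable fun p : SSLInstance n X Y × ℝ => d (points p.1 i) (points p.1 j) :=
      hd.comp ((hp i).prodMk (hp j))
    refine measurable_to_bool ?_
    have : (fun p => code p i j) ⁻¹' {true} =
        {p : SSLInstance n X Y × ℝ | d (points p.1 i) (points p.1 j) ≤ p.2} := by
      ext p; simp [code]
    rw [this]
    exact measurableSet_le h1 measurable_snd
  have : (fun p : SSLInstance n X Y × ℝ => loss d A ℓ p.1 p.2) = fun p => F (code p, p.1) := by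
    funext p
    have hG : thresholdGraph d p.2 p.1 = G (code p) := by
      funext i j; simp [thresholdGraph, thresholdKernel, G, code]
    simp only [loss, unlabeled, F, Finset.sum_filter, hG]
  rw [this]
  exact hF.comp (hcode.prodMk measurable_fst)

lemma measurable_avgLoss {d : X → X → ℝ} {A : LabelingAlgorithm n X Y} {ℓ : Y → Y → ℝ}
    (hd : Measurable (Function.uncurry d)) (hℓ : Measurable (Function.uncurry ℓ))
    (hA : ∀ w u, Measurable fun J : SSLInstance n X Y => A w (points J) (visibleLabels J) u) :
    Measurable fun p : SSLInstance n X Y × ℝ => avgLoss d A ℓ p.1 p.2 := by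
  refine (measurable_loss hd hℓ hA).div ?_
  have : (fun p : SSLInstance n X Y × ℝ => ((unlabeled p.1).card : ℝ)) =
      fun p => ∑ u, if (p.1 u).2.1 = true then (1 : ℝ) else 0 := by
    funext p; simp [unlabeled]
  rw [this]
  refine Finset.measurable_sum _ fun u _ => Measurable.ite ?_ measurable_const measurable_const
  exact measurableSet_eq_fun (by fun_prop) measurable_const

end

/-! ### Expected maximum of infinitely many counts of independent events -/

section Counting

variable {Ω : Type*} [MeasurableSpace Ω] {μ : Measure Ω} [IsProbabilityMeasure μ]

/-- Since `e < 3`, the exponential of an indicator is at most `1 + 2 · 1_E`. -/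
lemma mgf_indicator_le {E : Set Ω} (hE : MeasurableSet E) :
    mgf (E.indicator (fun _ => (1 : ℝ))) μ 1 ≤ Real.exp (2 * μ.real E) := by
  have h1 : ∀ ω, Real.exp (1 * E.indicator (fun _ => (1 : ℝ)) ω) ≤
      1 + E.indicator (fun _ => (2 : ℝ)) ω := by
    intro ω
    by_cases h : ω ∈ E
    · simp only [h, indicator_of_mem, mul_one]
      have := Real.exp_one_lt_d9
      linarith
    · simp [h]
  have h2 : Integrable (fun ω => 1 + E.indicator (fun _ => (2 : ℝ)) ω) μ :=
    (integrable_const 1).add ((integrable_const 2).indicator hE)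
  calc mgf (E.indicator (fun _ => (1 : ℝ))) μ 1
      ≤ ∫ ω, (1 + E.indicator (fun _ => (2 : ℝ)) ω) ∂μ :=
        integral_mono_of_nonneg (ae_of_all _ fun ω => (Real.exp_pos _).le) h2 (ae_of_all _ h1)
    _ = 2 * μ.real E + 1 := by
        rw [integral_add (integrable_const 1) ((integrable_const 2).indicator hE),
          integral_indicator hE]
        simp
        ring
    _ ≤ _ := Real.add_one_le_exp _

/-- Independence gives `E[exp N] ≤ exp(2m)` with `m` the expected count. Subtracting `1` produces
the factor `m`, by `exp(2m) - 1 ≤ 2m exp(2m)`; only the exponent is replaced by the uniform bound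
`TP`. That linear factor is what can later be summed over all windows. -/
lemma lintegral_exp_count_sub_one_le {E : ℕ → Set Ω} (hE : ∀ t, MeasurableSet (E t))
    (hind : iIndepFun (fun t => (E t).indicator (fun _ => (1 : ℝ))) μ) {P : ℝ}
    (hP : ∀ t, μ.real (E t) ≤ P) (T : ℕ) :
    ∫⁻ ω, ENNReal.ofReal
        (Real.exp (∑ t ∈ Finset.range T, (E t).indicator (fun _ => (1 : ℝ)) ω) - 1) ∂μ
      ≤ ENNReal.ofReal (2 * Real.exp (2 * T * P)) * ∑ t ∈ Finset.range T, μ (E t) := by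
  set N : Ω → ℝ := fun ω => ∑ t ∈ Finset.range T, (E t).indicator (fun _ => (1 : ℝ)) ω with hN
  have hmeas : ∀ t, Measurable ((E t).indicator (fun _ => (1 : ℝ))) := fun t =>
    measurable_const.indicator (hE t)
  have hN0 : ∀ ω, 0 ≤ N ω := fun ω => Finset.sum_nonneg fun t _ =>
    indicator_nonneg (fun _ _ => zero_le_one) _
  have hNm : Measurable N := Finset.measurable_sum _ fun t _ => hmeas t
  have hNT : ∀ ω, N ω ≤ T := fun ω => by
    refine (Finset.sum_le_card_nsmul _ _ 1 fun t _ => ?_).trans (by simp)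
    exact indicator_le_self' (fun _ _ => zero_le_one) ω
  have hint : Integrable (fun ω => Real.exp (N ω)) μ := by
    refine Integrable.of_bound (Real.measurable_exp.comp hNm).aestronglyMeasurable
      (Real.exp T) (ae_of_all _ fun ω => ?_)
    rw [Real.norm_eq_abs, abs_of_pos (Real.exp_pos _)]
    exact Real.exp_le_exp.2 (hNT ω)
  set m : ℝ := ∑ t ∈ Finset.range T, μ.real (E t) with hm
  have hm0 : 0 ≤ m := Finset.sum_nonneg fun _ _ => measureReal_nonneg
  have hmP : m ≤ T * P := by
    refine (Finset.sum_le_card_nsmul _ _ P fun t _ => hP t).trans (by simp)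
  have hexp : ∫ ω, Real.exp (N ω) ∂μ ≤ Real.exp (2 * m) := by
    have h := hind.mgf_sum (t := 1) hmeas (Finset.range T)
    have h' : ∫ ω, Real.exp (N ω) ∂μ =
        mgf (∑ t ∈ Finset.range T, (E t).indicator (fun _ => (1 : ℝ))) μ 1 := by
      simp [mgf, N, Finset.sum_apply]
    rw [h', h, hm, Finset.mul_sum, Real.exp_sum]
    exact Finset.prod_le_prod (fun t _ => mgf_nonneg) fun t _ => mgf_indicator_le (hE t)
  have hsum : ∑ t ∈ Finset.range T, μ (E t) = ENNReal.ofReal m := by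
    rw [hm, ENNReal.ofReal_sum_of_nonneg fun _ _ => measureReal_nonneg]
    simp
  have heq := ofReal_integral_eq_lintegral_ofReal (f := fun ω => Real.exp (N ω) - 1)
    (hint.sub (integrable_const 1))
    (ae_of_all _ fun ω => sub_nonneg.2 (Real.one_le_exp (hN0 ω)))
  rw [hsum, ← ENNReal.ofReal_mul (by positivity), ← heq]
  refine ENNReal.ofReal_le_ofReal ?_
  rw [integral_sub hint (integrable_const 1)]
  simp only [integral_const, probReal_univ, smul_eq_mul, mul_one]
  have h1 : Real.exp (2 * m) - 1 ≤ 2 * m * Real.exp (2 * m) := by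
    have h2 := Real.add_one_le_exp (-(2 * m))
    have h3 : Real.exp (-(2 * m)) * Real.exp (2 * m) = 1 := by
      rw [← Real.exp_add]; simp
    nlinarith [Real.exp_pos (2 * m)]
  have h2 : Real.exp (2 * m) ≤ Real.exp (2 * T * P) := Real.exp_le_exp.2 (by linarith)
  nlinarith [mul_le_mul_of_nonneg_left h2 (by linarith : 0 ≤ 2 * m)]

/-- The expected maximum, over countably many indices, of the number of occurring events. -/
lemma lintegral_iSup_count_le {E : ℕ → ℕ → Set Ω} (hE : ∀ t k, MeasurableSet (E t k))
    (hind : ∀ k, iIndepFun (fun t => (E t k).indicator (fun _ => (1 : ℝ))) μ) {P Q : ℝ}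
    (hP0 : 0 ≤ P) (hQ0 : 0 ≤ Q) (hP : ∀ t k, μ.real (E t k) ≤ P)
    (hQ : ∀ t, ∑' k, μ (E t k) ≤ ENNReal.ofReal Q) {T : ℕ} (hT : 1 ≤ T) :
    ∫⁻ ω, ⨆ k, ENNReal.ofReal
        (∑ t ∈ Finset.range T, (E t k).indicator (fun _ => (1 : ℝ)) ω) ∂μ
      ≤ ENNReal.ofReal (2 * T * P + Real.log T + 4 * Q) := by
  set N : ℕ → Ω → ℝ := fun k ω => ∑ t ∈ Finset.range T, (E t k).indicator (fun _ => (1 : ℝ)) ω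
    with hN
  -- This truncation level makes `exp(-s) · exp(2TP) · T = 1`, so the part above it contributes just
  -- `4Q`.
  set s : ℝ := 2 * T * P + Real.log T with hs
  have hs0 : 0 ≤ s := add_nonneg (by positivity) (Real.log_nonneg (by exact_mod_cast hT))
  set c : ℝ := 2 * Real.exp (-s) with hc
  have hNm : ∀ k, Measurable (N k) := fun k =>
    Finset.measurable_sum _ fun t _ => measurable_const.indicator (hE t k)
  have hN0 : ∀ k ω, N k ω = 0 ∨ 1 ≤ N k ω := by
    intro k ω
    have : N k ω = ((∑ t ∈ Finset.range T, (E t k).indicator (fun _ => (1 : ℕ)) ω : ℕ) : ℝ) := by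
      rw [hN]
      push_cast
      refine Finset.sum_congr rfl fun t _ => ?_
      by_cases h : ω ∈ E t k <;> simp [h]
    rw [this]
    rcases Nat.eq_zero_or_pos (∑ t ∈ Finset.range T, (E t k).indicator (fun _ => (1 : ℕ)) ω)
      with h | h
    · left; exact_mod_cast h
    · right; exact_mod_cast h
  -- The excess over `s` is bounded by a quantity that vanishes when `N = 0`, so that its sum over
  -- all `k` can be finite. For `N ≥ 1` one has `exp N ≤ 2 (exp N - 1)`; this is where integrality
  -- of `N` enters.
  have hpt : ∀ k ω, N k ω ≤ s + c * (Real.exp (N k ω) - 1) := by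
    intro k ω
    rcases hN0 k ω with h | h
    · rw [h]; simpa using hs0
    · have h1 : Real.exp (N k ω) ≤ 2 * (Real.exp (N k ω) - 1) := by
        have := Real.add_one_le_exp (N k ω)
        linarith
      have h2 := Real.add_one_le_exp (N k ω - s)
      have h3 : Real.exp (N k ω - s) = Real.exp (-s) * Real.exp (N k ω) := by
        rw [← Real.exp_add]; ring_nf
      have h4 := mul_le_mul_of_nonneg_left h1 (Real.exp_pos (-s)).le
      rw [hc]
      linarith
  have hsup : ∀ ω, ⨆ k, ENNReal.ofReal (N k ω) ≤ ENNReal.ofReal s +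
      ∑' k, ENNReal.ofReal c * ENNReal.ofReal (Real.exp (N k ω) - 1) := by
    intro ω
    refine iSup_le fun k => ?_
    refine (ENNReal.ofReal_le_ofReal (hpt k ω)).trans (ENNReal.ofReal_add_le.trans ?_)
    gcongr
    rw [ENNReal.ofReal_mul (by positivity)]
    exact ENNReal.le_tsum (f := fun k => ENNReal.ofReal c * ENNReal.ofReal (Real.exp (N k ω) - 1)) k
  have hmeas : ∀ k, Measurable fun ω => ENNReal.ofReal (Real.exp (N k ω) - 1) := fun k =>
    ((Real.measurable_exp.comp (hNm k)).sub measurable_const).ennreal_ofReal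
  calc ∫⁻ ω, ⨆ k, ENNReal.ofReal (N k ω) ∂μ
      ≤ ∫⁻ ω, (ENNReal.ofReal s +
          ∑' k, ENNReal.ofReal c * ENNReal.ofReal (Real.exp (N k ω) - 1)) ∂μ := lintegral_mono hsup
    _ = ENNReal.ofReal s +
          ∑' k, ENNReal.ofReal c * ∫⁻ ω, ENNReal.ofReal (Real.exp (N k ω) - 1) ∂μ := by
        rw [lintegral_add_left measurable_const,
          lintegral_tsum fun k => ((hmeas k).const_mul _).aemeasurable]
        simp only [lintegral_const, measure_univ, mul_one]
        congr 2
        funext k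
        rw [lintegral_const_mul _ (hmeas k)]
    _ ≤ ENNReal.ofReal s + ∑' k, ENNReal.ofReal c *
          (ENNReal.ofReal (2 * Real.exp (2 * T * P)) * ∑ t ∈ Finset.range T, μ (E t k)) := by
        gcongr with k
        exact lintegral_exp_count_sub_one_le (fun t => hE t k) (hind k) (fun t => hP t k) T
    _ = ENNReal.ofReal s + ENNReal.ofReal c * (ENNReal.ofReal (2 * Real.exp (2 * T * P)) *
          ∑ t ∈ Finset.range T, ∑' k, μ (E t k)) := by
        rw [ENNReal.tsum_mul_left, ENNReal.tsum_mul_left,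
          Summable.tsum_finsetSum fun t _ => ENNReal.summable]
    _ ≤ ENNReal.ofReal s + ENNReal.ofReal c * (ENNReal.ofReal (2 * Real.exp (2 * T * P)) *
          ∑ t ∈ Finset.range T, ENNReal.ofReal Q) := by
        gcongr with t
        exact hQ t
    _ = ENNReal.ofReal (s + 4 * Q) := by
        rw [Finset.sum_const, Finset.card_range, nsmul_eq_mul, ← ENNReal.ofReal_natCast,
          ← ENNReal.ofReal_mul (by positivity), ← ENNReal.ofReal_mul (by positivity),
          ← ENNReal.ofReal_mul (by positivity), ← ENNReal.ofReal_add hs0 (by positivity)]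
        congr 2
        have hT0 : (0 : ℝ) < T := by exact_mod_cast hT
        have h1 : Real.exp (-s) * Real.exp (2 * T * P) * T = 1 := by
          conv_lhs => rw [← Real.exp_log hT0]
          rw [Real.exp_log hT0, ← Real.exp_add, hs]
          rw [show -(2 * T * P + Real.log T) + 2 * T * P = - Real.log T by ring, Real.exp_neg,
            Real.exp_log hT0]
          field_simp
        rw [hc]
        linear_combination 4 * Q * h1

end Counting

/-! ### Nonconstancy on half-open windows and the mass of the windows -/

/-- The functions that take two different values at rational points of `[x, y)`. -/
def nonconstantOn (x y : ℝ) : Set (ℝ → ℝ) :=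
  ⋃ p : ℚ, ⋃ q : ℚ, {f | (x ≤ p ∧ (p : ℝ) < y) ∧ (x ≤ q ∧ (q : ℝ) < y) ∧ f p ≠ f q}

lemma measurableSet_nonconstantOn (x y : ℝ) : MeasurableSet (nonconstantOn x y) := by
  refine MeasurableSet.iUnion fun p => MeasurableSet.iUnion fun q => ?_
  refine (MeasurableSet.const _).inter ((MeasurableSet.const _).inter ?_)
  exact (measurableSet_eq_fun (f := fun f : ℝ → ℝ => f p) (g := fun f => f q)
    (measurable_pi_apply _) (measurable_pi_apply _)).compl

/-- Right-constancy moves a point to a nearby rational on its right without leaving a window that is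
open on the right. Thus the countable, measurable condition in `nonconstantOn` detects every change
at real points. -/
lemma exists_rat_eq {f : ℝ → ℝ} {S : Set ℝ} (hf : PiecewiseConstantOn f (Ici 0) S)
    {z y : ℝ} (hz : 0 ≤ z) (hzy : z < y) :
    ∃ p : ℚ, z ≤ p ∧ (p : ℝ) < y ∧ f p = f z := by
  obtain ⟨δ, hδ, h⟩ := exists_right_const hf.1 hf.2.1 (r := z) hz
  obtain ⟨p, hp1, hp2⟩ := exists_rat_btwn (lt_min hzy (lt_add_of_pos_right z hδ))
  exact ⟨p, hp1.le, hp2.trans_le (min_le_left _ _),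
    h p (hz.trans hp1.le) hp1.le (hp2.trans_le (min_le_right _ _))⟩

lemma mem_nonconstantOn {f : ℝ → ℝ} {S : Set ℝ} (hf : PiecewiseConstantOn f (Ici 0) S)
    {x y z z' : ℝ} (hx : 0 ≤ x) (hz : z ∈ Ico x y) (hz' : z' ∈ Ico x y) (hne : f z ≠ f z') :
    f ∈ nonconstantOn x y := by
  obtain ⟨p, hp1, hp2, hp⟩ := exists_rat_eq hf (hx.trans hz.1) hz.2
  obtain ⟨q, hq1, hq2, hq⟩ := exists_rat_eq hf (hx.trans hz'.1) hz'.2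
  exact mem_iUnion₂.2 ⟨p, q, ⟨hz.1.trans hp1, hp2⟩, ⟨hz'.1.trans hq1, hq2⟩, by rwa [hp, hq]⟩

lemma exists_breakpoint_of_mem_nonconstantOn {f : ℝ → ℝ} {S : Set ℝ}
    (hf : PiecewiseConstantOn f (Ici 0) S) {x y : ℝ} (hx : 0 ≤ x)
    (h : f ∈ nonconstantOn x y) : ∃ s ∈ S, s ∈ Ico x y := by
  obtain ⟨p, q, ⟨hp1, hp2⟩, ⟨hq1, hq2⟩, hne⟩ := mem_iUnion₂.1 h
  have key : ∀ u v : ℝ, x ≤ u → v < y → u ≤ v → f u ≠ f v → ∃ s ∈ S, s ∈ Ico x y := by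
    intro u v hu hv huv hne
    by_contra hno
    refine hne (hf.2.1 u (hx.trans hu) v (hx.trans (hu.trans huv)) huv ?_)
    exact Set.disjoint_left.2 fun s hs hsS =>
      hno ⟨s, hsS, hu.trans hs.1.le, hs.2.trans_lt hv⟩
  rcases le_total (p : ℝ) q with hle | hle
  · exact key p q hp1 hq2 hle hne
  · exact key q p hq1 hp2 hle hne.symm

lemma KBounded.measure_Ico_le {κ : ℝ≥0} {ν : Measure ℝ} (h : KBounded κ ν) (x y : ℝ) :
    ν (Ico x y) ≤ κ * ENNReal.ofReal (y - x) := by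
  obtain ⟨f, hf, hfκ, rfl⟩ := h
  rw [withDensity_apply _ measurableSet_Ico]
  calc ∫⁻ a in Ico x y, f a ≤ ∫⁻ _ in Ico x y, (κ : ℝ≥0∞) := lintegral_mono fun a => hfκ a
    _ = _ := by rw [setLIntegral_const, Real.volume_Ico]

/-- Each window is the union of two consecutive cells of length `ε`. The cells are disjoint, so the
left halves and the right halves each have total mass at most `1`. -/
lemma tsum_measure_Ico_le (ν : Measure ℝ) [IsProbabilityMeasure ν] {ε : ℝ} (hε : 0 ≤ ε) :
    ∑' k : ℕ, ν (Ico (k * ε) ((k + 2) * ε)) ≤ 2 := by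
  have hmono : Monotone fun k : ℕ => (k : ℝ) * ε := fun i j hij => by
    have : (i : ℝ) ≤ j := by exact_mod_cast hij
    exact mul_le_mul_of_nonneg_right this hε
  have h1 : ∑' k : ℕ, ν (Ico ((k : ℝ) * ε) (((k + 1 : ℕ) : ℝ) * ε)) ≤ 1 := by
    have h := measure_iUnion (μ := ν)
      (f := fun k : ℕ => Ico ((k : ℝ) * ε) (((k + 1 : ℕ) : ℝ) * ε))
      (fun i j hij => hmono.pairwise_disjoint_on_Ico_succ hij) fun _ => measurableSet_Ico
    rw [← h]
    exact prob_le_one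
  have h2 : ∑' k : ℕ, ν (Ico (((k + 1 : ℕ) : ℝ) * ε) (((k + 1 + 1 : ℕ) : ℝ) * ε)) ≤ 1 := by
    refine le_trans ?_ h1
    exact ENNReal.tsum_comp_le_tsum_of_injective (add_left_injective 1)
      fun k : ℕ => ν (Ico ((k : ℝ) * ε) (((k + 1 : ℕ) : ℝ) * ε))
  calc ∑' k : ℕ, ν (Ico (k * ε) ((k + 2) * ε))
      ≤ ∑' k : ℕ, (ν (Ico ((k : ℝ) * ε) (((k + 1 : ℕ) : ℝ) * ε)) +
          ν (Ico (((k + 1 : ℕ) : ℝ) * ε) (((k + 1 + 1 : ℕ) : ℝ) * ε))) := by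
        refine ENNReal.tsum_le_tsum fun k => ?_
        refine (measure_mono ?_).trans (measure_union_le _ _)
        rw [Ico_union_Ico_eq_Ico (hmono k.le_succ) (hmono (k + 1).le_succ)]
        push_cast
        refine Ico_subset_Ico le_rfl (le_of_eq (by ring))
    _ ≤ 2 := by
        rw [ENNReal.tsum_add]
        exact (add_le_add h1 h2).trans (by norm_num)

/-! ### Dispersion of the losses -/

section

lemma lipschitzFailures_le {l : ℕ → ℝ → ℝ} {L : ℝ} {T : ℕ} {ρ ρ' : ℝ} (J : Finset ℕ)
    (h : ∀ t < T, L * |ρ - ρ'| < l t ρ - l t ρ' → t ∈ J) :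
    lipschitzFailures l L T ρ ρ' ≤ J.card := by
  rw [← Set.ncard_coe_finset]
  exact Set.ncard_le_ncard (fun t ht => h t ht.1 ht.2) J.finite_toSet

lemma lipschitzFailures_le_self (l : ℕ → ℝ → ℝ) (L : ℝ) (T : ℕ) (ρ ρ' : ℝ) :
    lipschitzFailures l L T ρ ρ' ≤ T := by
  simpa using lipschitzFailures_le (l := l) (L := L) (ρ := ρ) (ρ' := ρ') (Finset.range T)
    fun t ht _ => Finset.mem_range.2 ht

/-- Take the cell containing the smaller point; the other point is in it or in the next one, which
is why windows have length `2ε`. -/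
lemma exists_mem_Ico_mul {ε ρ ρ' : ℝ} (hε : 0 < ε) (hρ : 0 ≤ ρ) (hρ' : 0 ≤ ρ')
    (h : |ρ - ρ'| ≤ ε) :
    ∃ k : ℕ, ρ ∈ Ico (k * ε) ((k + 2) * ε) ∧ ρ' ∈ Ico (k * ε) ((k + 2) * ε) := by
  have hm : 0 ≤ min ρ ρ' / ε := div_nonneg (le_min hρ hρ') hε.le
  have h1 := (le_div_iff₀ hε).1 (Nat.floor_le hm)
  have h2 := (div_lt_iff₀ hε).1 (Nat.lt_floor_add_one (min ρ ρ' / ε))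
  rw [abs_le] at h
  refine ⟨⌊min ρ ρ' / ε⌋₊, ?_⟩
  generalize (⌊min ρ ρ' / ε⌋₊ : ℝ) = k at *
  rcases le_total ρ ρ' with hle | hle
  · rw [min_eq_left hle] at h1 h2
    refine ⟨⟨?_, ?_⟩, ?_, ?_⟩ <;> linarith
  · rw [min_eq_right hle] at h1 h2
    refine ⟨⟨?_, ?_⟩, ?_, ?_⟩ <;> linarith

lemma measurable_points [MeasurableSpace X] [MeasurableSpace Y] (i : Fin n) :
    Measurable fun J : SSLInstance n X Y => points J i := by
  unfold points
  fun_prop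

variable {Ω : Type*} [MeasurableSpace X] [MeasurableSpace Y] [MeasurableSpace Ω]
  {μ : Measure Ω}
  {d : X → X → ℝ} {A : LabelingAlgorithm n X Y} {ℓ : Y → Y → ℝ}

lemma measure_loss_nonconstantOn_le (hd0 : ∀ x, d x x = 0)
    (hd : Measurable (Function.uncurry d)) {I : Ω → SSLInstance n X Y} (hI : Measurable I)
    {x y : ℝ} (hx : 0 ≤ x) :
    μ {ω | loss d A ℓ (I ω) ∈ nonconstantOn x y} ≤
      ∑ p : Fin n × Fin n with p.1 ≠ p.2,
        (μ.map fun ω => d (points (I ω) p.1) (points (I ω) p.2)) (Ico x y) := by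
  have hm : ∀ p : Fin n × Fin n,
      Measurable fun ω => d (points (I ω) p.1) (points (I ω) p.2) := fun p => by
    have h : ∀ i, Measurable fun ω => points (I ω) i := fun i =>
      (measurable_points i).comp hI
    exact hd.comp ((h p.1).prodMk (h p.2))
  have h1 : ∀ p : Fin n × Fin n,
      (μ.map fun ω => d (points (I ω) p.1) (points (I ω) p.2)) (Ico x y) =
        μ {ω | d (points (I ω) p.1) (points (I ω) p.2) ∈ Ico x y} := fun p =>
    Measure.map_apply (hm p) measurableSet_Ico
  simp only [h1]
  refine (measure_mono ?_).trans (measure_biUnion_finset_le _ _)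
  intro ω hω
  obtain ⟨s, ⟨i, j, hij, rfl⟩, hs⟩ := exists_breakpoint_of_mem_nonconstantOn
    (loss_piecewiseConstantOn_Ici hd0 A ℓ (I ω)) hx hω
  exact mem_iUnion₂.2 ⟨(i, j), by simpa using hij, hs⟩

/-- The losses of the instances, or functions that change only where the losses change, are
`1/2`-dispersed. -/
lemma dispersedWith_of_loss [IsProbabilityMeasure μ] {κ : ℝ≥0} {I : ℕ → Ω → SSLInstance n X Y} (hd0 : ∀ x, d x x = 0)
    (hd : Measurable (Function.uncurry d)) (hℓ : Measurable (Function.uncurry ℓ))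
    (hA : ∀ w u, Measurable fun J : SSLInstance n X Y => A w (points J) (visibleLabels J) u)
    (hI : ∀ t, Measurable (I t))
    (hind : iIndepFun (fun (t : ℕ) (ω : Ω) (r : ℝ) => loss d A ℓ (I t ω) r) μ)
    (hκ : ∀ t, ∀ i j : Fin n, i ≠ j → KBounded κ
      (μ.map fun ω => d (points (I t ω) i) (points (I t ω) j)))
    {m : ℕ → Ω → ℝ → ℝ} (hm : ∀ t ω ρ ρ', loss d A ℓ (I t ω) ρ = loss d A ℓ (I t ω) ρ' →
      m t ω ρ = m t ω ρ') {L : ℝ} (hL : 0 ≤ L) :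
    DispersedWith μ m (Ici 0) (1 / 2) L (4 * n ^ 2 * κ + 1 + 8 * n ^ 2) 1 := by
  intro T hT ε hε
  have hT0 : (0 : ℝ) < T := by exact_mod_cast hT
  have hε0 : 0 < ε := (Real.rpow_pos_of_pos hT0 _).trans_le hε
  have hlog : 0 ≤ Real.log T := Real.log_nonneg (by exact_mod_cast hT)
  -- The only use of `ε ≥ T^(-1/2)`: it absorbs the terms `log T` and `8n²` into a multiple of `εT(1
  -- + log T)`.
  have hεT : 1 ≤ ε * T := by
    calc (1 : ℝ) ≤ (T : ℝ) ^ ((1 : ℝ) / 2) :=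
          Real.one_le_rpow (by exact_mod_cast hT) (by norm_num)
      _ = (T : ℝ) ^ (-((1 : ℝ) / 2)) * T := by
          nth_rewrite 3 [← Real.rpow_one (T : ℝ)]
          rw [← Real.rpow_add hT0]
          norm_num
      _ ≤ ε * T := by gcongr
  set E : ℕ → ℕ → Set Ω := fun t k =>
    {ω | loss d A ℓ (I t ω) ∈ nonconstantOn (k * ε) ((k + 2) * ε)} with hEdef
  have hloss : ∀ t, Measurable fun (ω : Ω) (r : ℝ) => loss d A ℓ (I t ω) r := fun t =>
    measurable_pi_lambda _ fun r =>
      (measurable_loss hd hℓ hA).comp ((hI t).prodMk measurable_const)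
  have hE : ∀ t k, MeasurableSet (E t k) := fun t k =>
    hloss t (measurableSet_nonconstantOn _ _)
  -- The window event is a measurable function of the whole loss function, so independence of the
  -- losses passes to it.
  have hindE : ∀ k, iIndepFun (fun t => (E t k).indicator (fun _ => (1 : ℝ))) μ := fun k =>
    hind.comp (fun _ => (nonconstantOn (k * ε) ((k + 2) * ε)).indicator fun _ => (1 : ℝ))
      fun _ => measurable_const.indicator (measurableSet_nonconstantOn _ _)
  have hEle : ∀ t k, μ (E t k) ≤ ∑ p : Fin n × Fin n with p.1 ≠ p.2,
      (μ.map fun ω => d (points (I t ω) p.1) (points (I t ω) p.2))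
        (Ico (k * ε) ((k + 2) * ε)) := fun t k =>
    measure_loss_nonconstantOn_le hd0 hd (hI t) (by positivity)
  have hcard : ((Finset.univ.filter fun p : Fin n × Fin n => p.1 ≠ p.2).card : ℝ≥0∞) ≤
      ENNReal.ofReal (n ^ 2) := by
    have h1 : (Finset.univ.filter fun p : Fin n × Fin n => p.1 ≠ p.2).card ≤ n ^ 2 := by
      refine (Finset.card_filter_le _ _).trans ?_
      simp [sq]
    rw [← Nat.cast_pow, ENNReal.ofReal_natCast]
    exact_mod_cast h1
  have hP : ∀ t k, μ.real (E t k) ≤ 2 * n ^ 2 * κ * ε := by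
    intro t k
    refine ENNReal.toReal_le_of_le_ofReal (by positivity) ((hEle t k).trans ?_)
    calc ∑ p : Fin n × Fin n with p.1 ≠ p.2,
          (μ.map fun ω => d (points (I t ω) p.1) (points (I t ω) p.2))
            (Ico (k * ε) ((k + 2) * ε))
        ≤ ∑ p : Fin n × Fin n with p.1 ≠ p.2, (κ : ℝ≥0∞) * ENNReal.ofReal (2 * ε) := by
          refine Finset.sum_le_sum fun p hp => ?_
          refine ((hκ t p.1 p.2 (Finset.mem_filter.1 hp).2).measure_Ico_le _ _).trans_eq ?_
          congr 2
          ring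
      _ ≤ ENNReal.ofReal (n ^ 2) * (κ * ENNReal.ofReal (2 * ε)) := by
          rw [Finset.sum_const, nsmul_eq_mul]
          gcongr
      _ = ENNReal.ofReal (2 * n ^ 2 * κ * ε) := by
          rw [← ENNReal.ofReal_coe_nnreal, ← ENNReal.ofReal_mul (by positivity),
            ← ENNReal.ofReal_mul (by positivity)]
          congr 1
          ring
  have hQ : ∀ t, ∑' k, μ (E t k) ≤ ENNReal.ofReal (2 * n ^ 2) := by
    intro t
    calc ∑' k, μ (E t k)
        ≤ ∑' k : ℕ, ∑ p : Fin n × Fin n with p.1 ≠ p.2,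
          (μ.map fun ω => d (points (I t ω) p.1) (points (I t ω) p.2))
            (Ico (k * ε) ((k + 2) * ε)) := ENNReal.tsum_le_tsum (hEle t)
      _ = ∑ p : Fin n × Fin n with p.1 ≠ p.2, ∑' k : ℕ,
          (μ.map fun ω => d (points (I t ω) p.1) (points (I t ω) p.2))
            (Ico (k * ε) ((k + 2) * ε)) :=
          Summable.tsum_finsetSum fun _ _ => ENNReal.summable
      _ ≤ ∑ p : Fin n × Fin n with p.1 ≠ p.2, 2 := by
          refine Finset.sum_le_sum fun p _ => ?_
          have h : ∀ i, Measurable fun ω => points (I t ω) i := fun i =>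
            (measurable_points i).comp (hI t)
          have : IsProbabilityMeasure
              (μ.map fun ω => d (points (I t ω) p.1) (points (I t ω) p.2)) :=
            Measure.isProbabilityMeasure_map
              (hd.comp ((h p.1).prodMk (h p.2))).aemeasurable
          exact tsum_measure_Ico_le _ hε0.le
      _ ≤ ENNReal.ofReal (n ^ 2) * 2 := by
          rw [Finset.sum_const, nsmul_eq_mul]
          gcongr
      _ = ENNReal.ofReal (2 * n ^ 2) := by
          rw [mul_comm 2, ENNReal.ofReal_mul (by positivity)]
          simp
  calc ∫⁻ ω, (⨆ ρ ∈ Ici (0 : ℝ), ⨆ ρ' ∈ Ici (0 : ℝ), ⨆ _ : |ρ - ρ'| ≤ ε,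
        (lipschitzFailures (fun t => m t ω) L T ρ ρ' : ℝ≥0∞)) ∂μ
      ≤ ∫⁻ ω, ⨆ k, ENNReal.ofReal
          (∑ t ∈ Finset.range T, (E t k).indicator (fun _ => (1 : ℝ)) ω) ∂μ := by
        refine lintegral_mono fun ω => iSup₂_le fun ρ hρ => iSup₂_le fun ρ' hρ' =>
          iSup_le fun hρρ' => ?_
        obtain ⟨k, hk, hk'⟩ := exists_mem_Ico_mul hε0 hρ hρ' hρρ'
        refine le_iSup_of_le k ?_
        classical
        have h1 : ∑ t ∈ Finset.range T, (E t k).indicator (fun _ => (1 : ℝ)) ω =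
            ((Finset.range T).filter fun t => ω ∈ E t k).card := by
          simp [Set.indicator_apply]
        rw [h1, ENNReal.ofReal_natCast]
        refine Nat.cast_le.2 (lipschitzFailures_le _ fun t ht hfail => ?_)
        refine Finset.mem_filter.2 ⟨Finset.mem_range.2 ht, ?_⟩
        refine mem_nonconstantOn (loss_piecewiseConstantOn_Ici hd0 A ℓ (I t ω))
          (by positivity) hk hk' fun heq => ?_
        have h2 : m t ω ρ = m t ω ρ' := hm t ω ρ ρ' heq
        have h3 : 0 ≤ L * |ρ - ρ'| := by positivity
        simp only [h2, sub_self] at hfail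
        exact absurd hfail (not_lt.2 h3)
    _ ≤ ENNReal.ofReal (2 * T * (2 * n ^ 2 * κ * ε) + Real.log T + 4 * (2 * n ^ 2)) :=
        lintegral_iSup_count_le hE hindE (by positivity) (by positivity) hP hQ hT
    _ ≤ _ := by
        refine ENNReal.ofReal_le_ofReal ?_
        rw [pow_one]
        have hn : (0 : ℝ) ≤ n ^ 2 := by positivity
        have hnκ : (0 : ℝ) ≤ 4 * n ^ 2 * κ := by positivity
        nlinarith [mul_nonneg (mul_nonneg hnκ (zero_le_one.trans hεT)) hlog,
          mul_le_mul_of_nonneg_right hεT hlog,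
          mul_nonneg (mul_nonneg hn (zero_le_one.trans hεT)) hlog,
          mul_le_mul_of_nonneg_left hεT hn]

end

/-! ### The exponential forecaster on a fixed sequence of losses -/

section Forecaster

variable {lam a b : ℝ} {l : ℕ → ℝ → ℝ}

lemma expWeight_eq (lam : ℝ) (l : ℕ → ℝ → ℝ) (t : ℕ) (r : ℝ) :
    expWeight lam l t r = Real.exp (lam * (t - ∑ s ∈ Finset.range t, l s r)) := by
  induction t with
  | zero => simp [expWeight]
  | succ t ih =>
    rw [expWeight, ih, ← Real.exp_add, Finset.sum_range_succ]
    push_cast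
    ring_nf

lemma expWeight_pos (lam : ℝ) (l : ℕ → ℝ → ℝ) (t : ℕ) (r : ℝ) : 0 < expWeight lam l t r := by
  rw [expWeight_eq]; exact Real.exp_pos _

lemma expWeight_le (hlam : 0 ≤ lam) (hl : ∀ t r, l t r ∈ Icc (0 : ℝ) 1) (t : ℕ) (r : ℝ) :
    expWeight lam l t r ≤ Real.exp (lam * t) := by
  rw [expWeight_eq]
  have : 0 ≤ ∑ s ∈ Finset.range t, l s r := Finset.sum_nonneg fun s _ => (hl s r).1
  gcongr
  linarith

lemma measurable_expWeight (hm : ∀ t, Measurable (l t)) (t : ℕ) :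
    Measurable (expWeight lam l t) := by
  have : expWeight lam l t = fun r => Real.exp (lam * (t - ∑ s ∈ Finset.range t, l s r)) :=
    funext fun r => expWeight_eq lam l t r
  rw [this]
  fun_prop

lemma integrableOn_expWeight (hlam : 0 ≤ lam) (hl : ∀ t r, l t r ∈ Icc (0 : ℝ) 1)
    (hm : ∀ t, Measurable (l t)) (t : ℕ) :
    IntegrableOn (expWeight lam l t) (Icc a b) := by
  refine Integrable.of_bound (measurable_expWeight hm t).aestronglyMeasurable
    (Real.exp (lam * t)) (ae_of_all _ fun r => ?_)
  rw [Real.norm_eq_abs, abs_of_pos (expWeight_pos _ _ _ _)]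
  exact expWeight_le hlam hl t r

lemma integral_expWeight_pos (hab : a < b) (hlam : 0 ≤ lam) (hl : ∀ t r, l t r ∈ Icc (0 : ℝ) 1)
    (hm : ∀ t, Measurable (l t)) (t : ℕ) : 0 < ∫ r in Icc a b, expWeight lam l t r := by
  rw [integral_pos_iff_support_of_nonneg (fun r => (expWeight_pos _ _ _ _).le)
    (integrableOn_expWeight hlam hl hm t)]
  have : Function.support (expWeight lam l t) = univ :=
    eq_univ_of_forall fun r => (expWeight_pos _ _ _ _).ne'
  simp [this, hab]

lemma isProbabilityMeasure_samplingDist (hab : a < b) (hlam : 0 ≤ lam)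
    (hl : ∀ t r, l t r ∈ Icc (0 : ℝ) 1) (hm : ∀ t, Measurable (l t)) (t : ℕ) :
    IsProbabilityMeasure (samplingDist (Icc a b) lam l t) := by
  have hpos := integral_expWeight_pos hab hlam hl hm t
  constructor
  rw [samplingDist, withDensity_apply _ MeasurableSet.univ, Measure.restrict_univ,
    ← ofReal_integral_eq_lintegral_ofReal ((integrableOn_expWeight hlam hl hm t).div_const _)
      (ae_of_all _ fun r => div_nonneg (expWeight_pos _ _ _ _).le hpos.le),
    integral_div, div_self hpos.ne', ENNReal.ofReal_one]

lemma integral_samplingDist (hm : ∀ t, Measurable (l t)) (C : Set ℝ) (t : ℕ) (f : ℝ → ℝ) :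
    ∫ r, f r ∂samplingDist C lam l t =
      (∫ r in C, expWeight lam l t r * f r) / ∫ r in C, expWeight lam l t r := by
  have hnn : 0 ≤ ∫ r in C, expWeight lam l t r :=
    integral_nonneg fun r => (expWeight_pos _ _ _ _).le
  rw [samplingDist, integral_withDensity_eq_integral_toReal_smul
    ((measurable_expWeight hm t).div_const _).ennreal_ofReal (ae_of_all _ fun _ =>
      ENNReal.ofReal_lt_top), ← integral_div]
  refine integral_congr_ae (ae_of_all _ fun r => ?_)
  simp only [smul_eq_mul]
  rw [ENNReal.toReal_ofReal (div_nonneg (expWeight_pos _ _ _ _).le hnn)]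
  ring

lemma integrable_of_mem_Icc {Ω : Type*} [MeasurableSpace Ω] {ν : Measure Ω} [IsFiniteMeasure ν]
    {f : Ω → ℝ} (hf : Measurable f) (h : ∀ x, f x ∈ Icc (0 : ℝ) 1) : Integrable f ν :=
  Integrable.of_bound hf.aestronglyMeasurable 1 (ae_of_all _ fun x => by
    rw [Real.norm_eq_abs, abs_of_nonneg (h x).1]; exact (h x).2)

/-- Apply `exp x ≤ 1 + x + x²` with `x = λ(1 - l) ∈ [0, λ]`, integrate against the current weights,
and close with `1 + y ≤ exp y`. -/
lemma integral_expWeight_succ_le (hab : a < b) (hlam : lam ∈ Ioc (0 : ℝ) 1)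
    (hl : ∀ t r, l t r ∈ Icc (0 : ℝ) 1) (hm : ∀ t, Measurable (l t)) (t : ℕ) :
    ∫ r in Icc a b, expWeight lam l (t + 1) r ≤ (∫ r in Icc a b, expWeight lam l t r) *
      Real.exp (lam * (1 - ∫ r, l t r ∂samplingDist (Icc a b) lam l t) + lam ^ 2) := by
  have hpos := integral_expWeight_pos hab hlam.1.le hl hm t
  have hint := integrableOn_expWeight (a := a) (b := b) hlam.1.le hl hm t
  have hint2 : IntegrableOn (fun r => expWeight lam l t r * l t r) (Icc a b) := by
    refine Integrable.mono' hint ((measurable_expWeight hm t).mul (hm t)).aestronglyMeasurable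
      (ae_of_all _ fun r => ?_)
    rw [Real.norm_eq_abs, abs_of_nonneg (mul_nonneg (expWeight_pos _ _ _ _).le (hl t r).1)]
    exact mul_le_of_le_one_right (expWeight_pos _ _ _ _).le (hl t r).2
  have hpt : ∀ r, expWeight lam l (t + 1) r ≤
      (1 + lam + lam ^ 2) * expWeight lam l t r - lam * (expWeight lam l t r * l t r) := by
    intro r
    rw [expWeight]
    have h0 : 0 ≤ lam * (1 - l t r) := mul_nonneg hlam.1.le (by linarith [(hl t r).2])
    have h1 : lam * (1 - l t r) ≤ lam :=
      mul_le_of_le_one_right hlam.1.le (by linarith [(hl t r).1])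
    have h2 := (abs_le.1 (Real.abs_exp_sub_one_sub_id_le
      (abs_le.2 ⟨by linarith, h1.trans hlam.2⟩))).2
    have h3 : (lam * (1 - l t r)) ^ 2 ≤ lam ^ 2 := pow_le_pow_left₀ h0 h1 2
    have h4 := mul_le_mul_of_nonneg_right (by linarith :
      Real.exp (lam * (1 - l t r)) ≤ 1 + lam * (1 - l t r) + lam ^ 2)
      (expWeight_pos lam l t r).le
    linarith
  calc ∫ r in Icc a b, expWeight lam l (t + 1) r
      ≤ ∫ r in Icc a b, ((1 + lam + lam ^ 2) * expWeight lam l t r -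
          lam * (expWeight lam l t r * l t r)) :=
        integral_mono (integrableOn_expWeight hlam.1.le hl hm (t + 1))
          ((hint.const_mul _).sub (hint2.const_mul _)) hpt
    _ = (∫ r in Icc a b, expWeight lam l t r) *
          (lam * (1 - ∫ r, l t r ∂samplingDist (Icc a b) lam l t) + lam ^ 2 + 1) := by
        rw [integral_sub (hint.const_mul _) (hint2.const_mul _), integral_const_mul,
          integral_const_mul, integral_samplingDist hm]
        field_simp
        ring
    _ ≤ _ := by
        gcongr
        exact Real.add_one_le_exp _

lemma integral_expWeight_le (hab : a < b) (hlam : lam ∈ Ioc (0 : ℝ) 1)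
    (hl : ∀ t r, l t r ∈ Icc (0 : ℝ) 1) (hm : ∀ t, Measurable (l t)) (T : ℕ) :
    ∫ r in Icc a b, expWeight lam l T r ≤ (b - a) * Real.exp (lam * T -
      lam * ∑ t ∈ Finset.range T, ∫ r, l t r ∂samplingDist (Icc a b) lam l t + lam ^ 2 * T) := by
  induction T with
  | zero => simp [expWeight, hab.le]
  | succ T ih =>
    refine (integral_expWeight_succ_le hab hlam hl hm T).trans ?_
    refine (mul_le_mul_of_nonneg_right ih (Real.exp_pos _).le).trans_eq ?_
    rw [mul_assoc, ← Real.exp_add, Finset.sum_range_succ]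
    push_cast
    ring_nf

/-- The interval starts at `ρ`, except near `b`, where it is pushed left to stay inside the domain.
-/
lemma exists_Icc_subset {h ρ : ℝ} (hh : 0 < h) (hhab : h ≤ b - a) (hρ : ρ ∈ Icc a b) :
    ∃ c, Icc c (c + h) ⊆ Icc a b ∧ ρ ∈ Icc c (c + h) := by
  refine ⟨min ρ (b - h), Icc_subset_Icc (le_min hρ.1 (by linarith)) ?_, min_le_left _ _, ?_⟩
  · linarith [min_le_right ρ (b - h)]
  · rcases le_total ρ (b - h) with h1 | h1
    · rw [min_eq_left h1]; linarith
    · rw [min_eq_right h1]; linarith [hρ.2]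

/-- For Lipschitz constant `0` a failure is any strict increase, and each costs at most `1` because
losses lie in `[0, 1]`. -/
lemma sum_le_sum_add_lipschitzFailures (hl : ∀ t r, l t r ∈ Icc (0 : ℝ) 1) (T : ℕ) (ρ ρ' : ℝ) :
    ∑ t ∈ Finset.range T, l t ρ ≤
      ∑ t ∈ Finset.range T, l t ρ' + lipschitzFailures l 0 T ρ ρ' := by
  classical
  have h1 : lipschitzFailures l 0 T ρ ρ' =
      ((Finset.range T).filter fun t => l t ρ' < l t ρ).card := by
    rw [lipschitzFailures, ← Set.ncard_coe_finset]
    congr 1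
    ext t
    simp
  rw [h1, Finset.card_filter, Nat.cast_sum, ← Finset.sum_add_distrib]
  refine Finset.sum_le_sum fun t _ => ?_
  split_ifs with h
  · push_cast; linarith [(hl t ρ).2, (hl t ρ').1]
  · push_cast; linarith

/-- The regret bound of the exponential forecaster for a fixed sequence of losses. -/
lemma sum_integral_samplingDist_le (hab : a < b) (hlam : lam ∈ Ioc (0 : ℝ) 1)
    (hl : ∀ t r, l t r ∈ Icc (0 : ℝ) 1) (hm : ∀ t, Measurable (l t)) {h : ℝ} (hh : 0 < h)
    (hhab : h ≤ b - a) {T : ℕ} {F : ℝ}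
    (hF : ∀ ρ ∈ Icc a b, ∀ ρ' ∈ Icc a b, |ρ - ρ'| ≤ h → (lipschitzFailures l 0 T ρ ρ' : ℝ) ≤ F)
    {ρ : ℝ} (hρ : ρ ∈ Icc a b) :
    ∑ t ∈ Finset.range T, ∫ r, l t r ∂samplingDist (Icc a b) lam l t ≤
      ∑ t ∈ Finset.range T, l t ρ + (F + Real.log ((b - a) / h) / lam + lam * T) := by
  obtain ⟨c, hc, hρc⟩ := exists_Icc_subset hh hhab hρ
  set e := ∑ t ∈ Finset.range T, ∫ r, l t r ∂samplingDist (Icc a b) lam l t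
  set v := ∑ t ∈ Finset.range T, l t ρ
  -- On the interval around `ρ` the cumulative loss is at most `v + F`, so this interval alone
  -- provides the lower bound.
  have hlow : h * Real.exp (lam * (T - v - F)) ≤ ∫ r in Icc a b, expWeight lam l T r := by
    calc h * Real.exp (lam * (T - v - F))
        = ∫ _ in Icc c (c + h), Real.exp (lam * (T - v - F)) := by
          simp [hh.le]
      _ ≤ ∫ r in Icc c (c + h), expWeight lam l T r := by
          refine setIntegral_mono_on (by simp) (integrableOn_expWeight hlam.1.le hl hm T)
            measurableSet_Icc fun r hr => ?_
          rw [expWeight_eq]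
          have h1 := sum_le_sum_add_lipschitzFailures hl T r ρ
          have h2 := hF r (hc hr) ρ hρ (by
            rw [abs_le]; constructor <;> linarith [hr.1, hr.2, hρc.1, hρc.2])
          refine Real.exp_le_exp.2 (mul_le_mul_of_nonneg_left ?_ hlam.1.le)
          linarith
      _ ≤ _ := setIntegral_mono_set (integrableOn_expWeight hlam.1.le hl hm T)
          (ae_of_all _ fun r => (expWeight_pos _ _ _ _).le) (ae_of_all _ hc)
  have hba : 0 < b - a := sub_pos.2 hab
  have h1 := Real.log_le_log (by positivity) (hlow.trans (integral_expWeight_le hab hlam hl hm T))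
  rw [Real.log_mul hh.ne' (Real.exp_pos _).ne', Real.log_mul hba.ne' (Real.exp_pos _).ne',
    Real.log_exp, Real.log_exp] at h1
  rw [Real.log_div hba.ne' hh.ne']
  have h2 : lam * e ≤ lam * (v + (F + (Real.log (b - a) - Real.log h) / lam + lam * T)) := by
    have h3 : lam * ((Real.log (b - a) - Real.log h) / lam) = Real.log (b - a) - Real.log h :=
      mul_div_cancel₀ _ hlam.1.ne'
    have h4 : lam * (v + (F + (Real.log (b - a) - Real.log h) / lam + lam * T)) =
        lam * v + lam * F + lam * ((Real.log (b - a) - Real.log h) / lam) + lam ^ 2 * T := by ring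
    rw [h4, h3]
    linarith
  exact le_of_mul_le_mul_left h2 hlam.1

lemma isProbabilityMeasure_runLaw (hab : a < b) (hlam : 0 ≤ lam)
    (hl : ∀ t r, l t r ∈ Icc (0 : ℝ) 1) (hm : ∀ t, Measurable (l t)) (T : ℕ) :
    IsProbabilityMeasure (runLaw (Icc a b) lam l T) := by
  have := fun t : ℕ => isProbabilityMeasure_samplingDist hab hlam hl hm t
  unfold runLaw
  infer_instance

lemma integrable_eval_runLaw (hab : a < b) (hlam : 0 ≤ lam)
    (hl : ∀ t r, l t r ∈ Icc (0 : ℝ) 1) (hm : ∀ t, Measurable (l t)) (T : ℕ) :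
    Integrable (fun ρ : Fin T → ℝ => ∑ t : Fin T, l t (ρ t)) (runLaw (Icc a b) lam l T) := by
  have := isProbabilityMeasure_runLaw hab hlam hl hm T
  exact integrable_finsetSum _ fun t _ => integrable_of_mem_Icc
    ((hm t).comp (measurable_pi_apply t)) fun ρ => hl t (ρ t)

lemma integrable_regret (hab : a < b) (hlam : 0 ≤ lam)
    (hl : ∀ t r, l t r ∈ Icc (0 : ℝ) 1) (hm : ∀ t, Measurable (l t)) (T : ℕ) :
    Integrable (regret (Icc a b) l T) (runLaw (Icc a b) lam l T) := by
  have := isProbabilityMeasure_runLaw hab hlam hl hm T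
  exact (integrable_eval_runLaw hab hlam hl hm T).sub (integrable_const _)

lemma integral_regret (hab : a < b) (hlam : 0 ≤ lam)
    (hl : ∀ t r, l t r ∈ Icc (0 : ℝ) 1) (hm : ∀ t, Measurable (l t)) (T : ℕ) :
    ∫ ρ, regret (Icc a b) l T ρ ∂runLaw (Icc a b) lam l T =
      ∑ t ∈ Finset.range T, ∫ r, l t r ∂samplingDist (Icc a b) lam l t -
        ⨅ r : Icc a b, ∑ t ∈ Finset.range T, l t r := by
  have := isProbabilityMeasure_runLaw hab hlam hl hm T
  have hs := fun t : ℕ => isProbabilityMeasure_samplingDist hab hlam hl hm t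
  have h1 : ∀ t : Fin T, ∫ ρ, l t (ρ t) ∂runLaw (Icc a b) lam l T =
      ∫ r, l t r ∂samplingDist (Icc a b) lam l t := fun t =>
    integral_comp_eval (μ := fun t : Fin T => samplingDist (Icc a b) lam l t)
      (hm t).aestronglyMeasurable
  simp only [regret]
  rw [integral_sub (integrable_eval_runLaw hab hlam hl hm T) (integrable_const _),
    integral_finsetSum (f := fun (t : Fin T) (ρ : Fin T → ℝ) => l t (ρ t)) _ fun t _ =>
      integrable_of_mem_Icc ((hm t).comp (measurable_pi_apply t)) fun ρ => hl t (ρ t)]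
  simp only [h1, integral_const, probReal_univ, smul_eq_mul, one_mul]
  rw [Fin.sum_univ_eq_sum_range
    (fun t => ∫ r, l t r ∂samplingDist (Icc a b) lam l t) T]
  congr 1
  exact iInf_congr fun r => Fin.sum_univ_eq_sum_range (fun t => l t r) T

end Forecaster

/-! ### Measurability and expected regret for random losses -/

section RandomLosses

open scoped Topology

variable {Ω : Type*} [MeasurableSpace Ω] {μ : Measure Ω}

lemma PiecewiseConstantOn.eventually_eq {f : ℝ → ℝ} {S : Set ℝ}
    (hf : PiecewiseConstantOn f (Ici 0) S) {r : ℝ} (hr : 0 ≤ r) :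
    ∀ᶠ r' in 𝓝[≥] r, f r' = f r := by
  obtain ⟨δ, hδ, h⟩ := exists_right_const hf.1 hf.2.1 (r := r) hr
  filter_upwards [Ico_mem_nhdsGE (lt_add_of_pos_right r hδ)] with r' hr'
  exact h r' (hr.trans hr'.1) hr'.1 hr'.2

/-- The infimum over an interval of right-constant random functions is measurable. -/
lemma measurable_iInf_Icc {f : Ω → ℝ → ℝ} {a b : ℝ} (ha : 0 ≤ a)
    (hf : ∀ r, Measurable fun ω => f ω r) (h0 : ∀ ω r, 0 ≤ f ω r)
    (hr : ∀ ω r, 0 ≤ r → ∀ᶠ r' in 𝓝[≥] r, f ω r' = f ω r) :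
    Measurable fun ω => ⨅ r : Icc a b, f ω r := by
  rcases isEmpty_or_nonempty (Icc a b) with hE | hE
  · simp
  -- Rationals suffice for `r < b` by right-constancy; `b` must be added since nothing to its right
  -- is in the interval.
  set D : Set ℝ := Icc a b ∩ insert b (range ((↑) : ℚ → ℝ)) with hD
  have hDc : D.Countable := ((countable_range _).insert b).mono inter_subset_right
  have : Countable D := hDc.to_subtype
  have hab : a ≤ b := by
    obtain ⟨r, hr⟩ := hE
    exact hr.1.trans hr.2
  have : Nonempty D := ⟨⟨b, ⟨hab, le_rfl⟩, mem_insert _ _⟩⟩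
  have heq : (fun ω => ⨅ r : Icc a b, f ω r) = fun ω => ⨅ r : D, f ω r := by
    funext ω
    refine le_antisymm (le_ciInf fun r => ?_) (le_ciInf fun r => ?_)
    · exact ciInf_le ⟨0, by rintro _ ⟨r, rfl⟩; exact h0 ω r⟩ (⟨r.1, r.2.1⟩ : Icc a b)
    · obtain ⟨r, hra, hrb⟩ := r
      suffices ∃ r' ∈ D, f ω r' = f ω r by
        obtain ⟨r', hr', he⟩ := this
        simp only
        rw [← he]
        exact ciInf_le (f := fun r : D => f ω r)
          ⟨0, by rintro _ ⟨r, rfl⟩; exact h0 ω r⟩ (⟨r', hr'⟩ : D)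
      rcases hrb.eq_or_lt with h | h
      · exact ⟨r, ⟨⟨hra, hrb⟩, by rw [h]; exact mem_insert _ _⟩, rfl⟩
      · obtain ⟨u, hu, hsub⟩ := mem_nhdsGE_iff_exists_Ico_subset.1 (hr ω r (ha.trans hra))
        obtain ⟨p, hp1, hp2⟩ := exists_rat_btwn (lt_min hu h)
        refine ⟨p, ⟨⟨hra.trans hp1.le, (hp2.trans_le (min_le_right _ _)).le⟩,
          mem_insert_of_mem _ ⟨p, rfl⟩⟩, hsub ⟨hp1.le, hp2.trans_le (min_le_left _ _)⟩⟩
  rw [heq]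
  exact Measurable.iInf fun r => hf r

lemma measurable_integral_samplingDist {l : ℕ → Ω → ℝ → ℝ}
    (hm : ∀ t, Measurable (Function.uncurry (l t))) (a b lam : ℝ) (t : ℕ) :
    Measurable fun ω => ∫ r, l t ω r ∂samplingDist (Icc a b) lam (fun s => l s ω) t := by
  have h1 : ∀ ω s, Measurable (l s ω) := fun ω s => (hm s).of_uncurry_left
  simp only [fun ω => integral_samplingDist (lam := lam) (h1 ω) (Icc a b) t (l t ω)]
  have hw : Measurable (Function.uncurry fun ω r => expWeight lam (fun s => l s ω) t r) := by
    have : (Function.uncurry fun ω r => expWeight lam (fun s => l s ω) t r) = fun p : Ω × ℝ =>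
        Real.exp (lam * (t - ∑ s ∈ Finset.range t, Function.uncurry (l s) p)) :=
      funext fun p => expWeight_eq lam (fun s => l s p.1) t p.2
    rw [this]
    fun_prop
  refine Measurable.div ?_ ?_
  · exact (StronglyMeasurable.integral_prod_right
      (f := fun ω r => expWeight lam (fun s => l s ω) t r * l t ω r)
      (hw.mul (hm t)).stronglyMeasurable).measurable
  · exact (StronglyMeasurable.integral_prod_right
      (f := fun ω r => expWeight lam (fun s => l s ω) t r) hw.stronglyMeasurable).measurable

/-- In the application `S` is a supremum over uncountably many pairs, for which no measurability is
proved. Only monotonicity of `∫⁻` and splitting off a constant are used. -/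
lemma integral_le_of_ofReal_le {g : Ω → ℝ} [IsProbabilityMeasure μ] (hg : Integrable g μ)
    {S : Ω → ℝ≥0∞} {c B : ℝ} (hc : 0 ≤ c) (hB : 0 ≤ B)
    (h : ∀ ω, ENNReal.ofReal (g ω) ≤ S ω + ENNReal.ofReal c)
    (hS : ∫⁻ ω, S ω ∂μ ≤ ENNReal.ofReal B) : ∫ ω, g ω ∂μ ≤ B + c := by
  rw [integral_eq_lintegral_pos_part_sub_lintegral_neg_part hg]
  refine (sub_le_self _ ENNReal.toReal_nonneg).trans ?_
  refine ENNReal.toReal_le_of_le_ofReal (by positivity) ?_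
  calc ∫⁻ ω, ENNReal.ofReal (g ω) ∂μ ≤ ∫⁻ ω, (S ω + ENNReal.ofReal c) ∂μ := lintegral_mono h
    _ = ∫⁻ ω, S ω ∂μ + ENNReal.ofReal c := by
        rw [lintegral_add_right _ measurable_const]; simp
    _ ≤ ENNReal.ofReal (B + c) := by
        rw [ENNReal.ofReal_add hB hc]; gcongr

lemma regret_const_mul (C : Set ℝ) (l : ℕ → ℝ → ℝ) (T : ℕ) (ρ : Fin T → ℝ) {c : ℝ} (hc : 0 ≤ c) :
    regret C (fun t r => c * l t r) T ρ = c * regret C l T ρ := by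
  simp only [regret, ← Finset.mul_sum]
  rw [← Real.mul_iInf_of_nonneg hc, mul_sub]

/-- The forecaster still runs on `l`; only the losses that measure its regret are rescaled. -/
lemma ExpectedRegretLE.const_mul {C : Set ℝ} {lam : ℝ} {l m : ℕ → Ω → ℝ → ℝ} {T : ℕ} {B c : ℝ}
    (hc : 0 ≤ c) (h : ExpectedRegretLE μ C lam l m T B) :
    ExpectedRegretLE μ C lam l (fun t ω r => c * m t ω r) T (c * B) := by
  obtain ⟨h1, h2, h3, h4⟩ := h
  have hreg : ∀ ω, regret C (fun t r => c * m t ω r) T =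
      fun ρ => c * regret C (fun t => m t ω) T ρ := fun ω =>
    funext fun ρ => regret_const_mul C (fun t => m t ω) T ρ hc
  refine ⟨h1, fun ω => ?_, ?_, ?_⟩
  · change Integrable (regret C (fun t r => c * m t ω r) T) _
    rw [hreg]
    exact (h2 ω).const_mul c
  · simp only [hreg, integral_const_mul]
    exact h3.const_mul c
  · simp only [hreg, integral_const_mul]
    exact mul_le_mul_of_nonneg_left h4 hc

lemma ExpectedRegretLE.mono {C : Set ℝ} {lam : ℝ} {l m : ℕ → Ω → ℝ → ℝ} {T : ℕ} {B B' : ℝ}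
    (h : ExpectedRegretLE μ C lam l m T B) (hB : B ≤ B') :
    ExpectedRegretLE μ C lam l m T B' :=
  ⟨h.1, h.2.1, h.2.2.1, h.2.2.2.trans hB⟩

/-- The exponential forecaster has expected regret `Õ(√T)` on `1/2`-dispersed losses. -/
lemma expectedRegretLE_of_dispersedWith [IsProbabilityMeasure μ] {l : ℕ → Ω → ℝ → ℝ} {a b K : ℝ}
    {q : ℕ} (ha : 0 ≤ a) (hab : a < b) (hK : 0 ≤ K) (hl : ∀ t ω r, l t ω r ∈ Icc (0 : ℝ) 1)
    (hm : ∀ t, Measurable (Function.uncurry (l t)))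
    (hr : ∀ t ω r, 0 ≤ r → ∀ᶠ r' in 𝓝[≥] r, l t ω r' = l t ω r)
    (hdisp : DispersedWith μ l (Ici 0) (1 / 2) 0 K q) {T : ℕ} (hT : 1 ≤ T) :
    ExpectedRegretLE μ (Icc a b) (1 / √T) l l T
      ((K + Real.log (max 1 (b - a)) + 1) * √T * (1 + Real.log T) ^ (q + 1)) := by
  have hT1 : (1 : ℝ) ≤ T := by exact_mod_cast hT
  have hsT : 1 ≤ √T := Real.one_le_sqrt.2 hT1
  have hsT0 : 0 < √T := one_pos.trans_le hsT
  have hlogT : 0 ≤ Real.log T := Real.log_nonneg hT1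
  set D : ℝ := max 1 (b - a) with hD
  have hD1 : 1 ≤ D := le_max_left _ _
  have hlogD : 0 ≤ Real.log D := Real.log_nonneg hD1
  have hba : 0 < b - a := sub_pos.2 hab
  have hlam : 1 / √T ∈ Ioc (0 : ℝ) 1 := ⟨by positivity, div_le_one_of_le₀ hsT hsT0.le⟩
  have hmω : ∀ ω t, Measurable (l t ω) := fun ω t => (hm t).of_uncurry_left
  have : Nonempty (Icc a b) := ⟨⟨a, le_rfl, hab.le⟩⟩
  have hprob := fun ω (t : ℕ) =>
    isProbabilityMeasure_samplingDist hab hlam.1.le (fun t r => hl t ω r) (hmω ω) t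
  have hint := fun ω => integral_regret hab hlam.1.le (fun t r => hl t ω r) (hmω ω) T
  have he : ∀ t ω,
      ∫ r, l t ω r ∂samplingDist (Icc a b) (1 / √T) (fun s => l s ω) t ∈ Icc (0 : ℝ) 1 := by
    intro t ω
    have := hprob ω t
    refine ⟨integral_nonneg fun r => (hl t ω r).1, ?_⟩
    calc ∫ r, l t ω r ∂samplingDist (Icc a b) (1 / √T) (fun s => l s ω) t
        ≤ ∫ _, 1 ∂samplingDist (Icc a b) (1 / √T) (fun s => l s ω) t :=
          integral_mono (integrable_of_mem_Icc (hmω ω t) (hl t ω)) (integrable_const 1)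
            fun r => (hl t ω r).2
      _ = 1 := by rw [integral_const, probReal_univ, one_smul]
  have hsum0 : ∀ ω r, 0 ≤ ∑ t ∈ Finset.range T, l t ω r := fun ω r =>
    Finset.sum_nonneg fun t _ => (hl t ω r).1
  have hinf_int : Integrable (fun ω => ⨅ r : Icc a b, ∑ t ∈ Finset.range T, l t ω r) μ := by
    refine Integrable.of_bound (C := T) (Measurable.aestronglyMeasurable ?_) (ae_of_all _ fun ω => ?_)
    · refine measurable_iInf_Icc (f := fun ω r => ∑ t ∈ Finset.range T, l t ω r) ha
        (fun r => ?_) hsum0 fun ω r hr0 => ?_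
      · exact Finset.measurable_sum _ fun t _ => (hm t).of_uncurry_right
      · filter_upwards [(Finset.eventually_all (Finset.range T)).2 fun t _ => hr t ω r hr0]
          with r' hr'
        exact Finset.sum_congr rfl hr'
    · rw [Real.norm_eq_abs, abs_of_nonneg (Real.iInf_nonneg fun r : Icc a b => hsum0 ω r)]
      refine (ciInf_le ⟨0, by rintro _ ⟨r, rfl⟩; exact hsum0 ω r⟩
        (⟨a, le_rfl, hab.le⟩ : Icc a b)).trans ?_
      exact (Finset.sum_le_card_nsmul _ _ 1 fun t _ => (hl t ω a).2).trans (by simp)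
  have hint_g : Integrable (fun ω => ∫ ρ, regret (Icc a b) (fun t => l t ω) T ρ
      ∂runLaw (Icc a b) (1 / √T) (fun t => l t ω) T) μ := by
    simp only [hint]
    exact (integrable_finsetSum _ fun t _ => integrable_of_mem_Icc
      (measurable_integral_samplingDist hm a b _ t) (he t)).sub hinf_int
  refine ⟨fun ω => isProbabilityMeasure_runLaw hab hlam.1.le (fun t r => hl t ω r) (hmω ω) T,
    fun ω => integrable_regret hab hlam.1.le (fun t r => hl t ω r) (hmω ω) T, hint_g, ?_⟩
  set ε : ℝ := (T : ℝ) ^ (-((1 : ℝ) / 2)) with hεdef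
  have hε : ε = 1 / √T := by
    rw [hεdef, Real.rpow_neg (by positivity), ← Real.sqrt_eq_rpow, one_div]
  have hεT : ε * T = √T := by
    rw [hε]
    nth_rewrite 2 [← Real.mul_self_sqrt (by positivity : (0 : ℝ) ≤ T)]
    field_simp
  -- This length is at most `ε = 1/√T`, so dispersion applies, and at most `b - a`, so the interval
  -- fits; the ratio `(b - a)/h` becomes `max 1 (b - a) · √T`.
  set h : ℝ := min 1 (b - a) / √T with hh
  have hmin : 0 < min 1 (b - a) := lt_min one_pos hba
  have hh0 : 0 < h := by positivity
  have hhba : h ≤ b - a := (div_le_self hmin.le hsT).trans (min_le_right _ _)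
  have hhε : h ≤ ε := by
    rw [hε, hh]
    gcongr
    exact min_le_left _ _
  have hdiv : (b - a) / h = D * √T := by
    have : (b - a) / min 1 (b - a) = D := by
      rcases le_total 1 (b - a) with hle | hle
      · rw [hD, min_eq_left hle, max_eq_right hle, div_one]
      · rw [hD, min_eq_right hle, max_eq_left hle, div_self hba.ne']
    rw [hh, div_div_eq_mul_div, mul_div_right_comm, this]
  have hlogh : Real.log ((b - a) / h) ≤ Real.log D + Real.log T := by
    rw [hdiv, Real.log_mul (by positivity) (by positivity), Real.log_sqrt (by positivity)]
    linarith
  set S : Ω → ℝ≥0∞ := fun ω => ⨆ ρ ∈ Ici (0 : ℝ), ⨆ ρ' ∈ Ici (0 : ℝ), ⨆ _ : |ρ - ρ'| ≤ ε,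
    (lipschitzFailures (fun t => l t ω) 0 T ρ ρ' : ℝ≥0∞) with hS
  have hST : ∀ ω, S ω ≠ ∞ := fun ω => by
    refine ne_top_of_le_ne_top (ENNReal.natCast_ne_top T) ?_
    exact iSup₂_le fun ρ _ => iSup₂_le fun ρ' _ => iSup_le fun _ =>
      Nat.cast_le.2 (lipschitzFailures_le_self _ _ _ _ _)
  set c : ℝ := (Real.log D + Real.log T + 1) * √T with hc
  have hbound : ∀ ω, ENNReal.ofReal (∫ ρ, regret (Icc a b) (fun t => l t ω) T ρ
      ∂runLaw (Icc a b) (1 / √T) (fun t => l t ω) T) ≤ S ω + ENNReal.ofReal c := by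
    intro ω
    rw [hint, ← ENNReal.ofReal_toReal (hST ω), ← ENNReal.ofReal_add ENNReal.toReal_nonneg
      (by positivity)]
    refine ENNReal.ofReal_le_ofReal ?_
    rw [sub_le_comm]
    refine le_ciInf fun r => ?_
    have hF : ∀ ρ ∈ Icc a b, ∀ ρ' ∈ Icc a b, |ρ - ρ'| ≤ h →
        (lipschitzFailures (fun t => l t ω) 0 T ρ ρ' : ℝ) ≤ (S ω).toReal := by
      intro ρ hρ ρ' hρ' hd
      rw [← ENNReal.toReal_natCast]
      refine ENNReal.toReal_mono (hST ω) ?_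
      exact le_iSup₂_of_le ρ (ha.trans hρ.1) (le_iSup₂_of_le ρ' (ha.trans hρ'.1)
        (le_iSup_of_le (hd.trans hhε) le_rfl))
    have hmain := sum_integral_samplingDist_le hab hlam (fun t r => hl t ω r) (hmω ω) hh0 hhba hF
      r.2
    have h1 : Real.log ((b - a) / h) / (1 / √T) ≤ (Real.log D + Real.log T) * √T := by
      rw [div_div_eq_mul_div, div_one]
      gcongr
    have h2 : 1 / √T * T = √T := by rw [← hε, hεT]
    rw [hc]
    linarith
  have hSint : ∫⁻ ω, S ω ∂μ ≤ ENNReal.ofReal (K * √T * (1 + Real.log T) ^ q) := by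
    have := hdisp T hT ε le_rfl
    rwa [hεT] at this
  refine (integral_le_of_ofReal_le hint_g (by positivity) (by positivity) hbound hSint).trans ?_
  -- The exponent `q + 1` leaves room for the factor `log T` from `log((b-a)/h)` even when `q = 0`.
  have hp1 : (1 + Real.log T) ^ q ≤ (1 + Real.log T) ^ (q + 1) :=
    pow_le_pow_right₀ (by linarith) (by omega)
  have hp2 : 1 + Real.log T ≤ (1 + Real.log T) ^ (q + 1) :=
    le_self_pow₀ (by linarith) (by omega)
  have h1 := mul_le_mul_of_nonneg_left hp1 (by positivity : 0 ≤ K * √T)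
  have h2 := mul_le_mul_of_nonneg_left hp2 (by positivity : 0 ≤ (Real.log D + 1) * √T)
  have h3 : c ≤ (Real.log D + 1) * √T * (1 + Real.log T) := by
    rw [hc]
    nlinarith [mul_nonneg (mul_nonneg hlogD hlogT) hsT0.le]
  linarith

end RandomLosses

end GraphSSL

end

/-! ### Assembly of the theorem -/

theorem mainTheorem2 (n : ℕ) (κ : ℝ≥0) :
    ∃ (K : ℝ) (q : ℕ), ∀ a b : ℝ, 0 ≤ a → a < b →
    ∃ (K' : ℝ) (q' : ℕ) (lam : ℕ → ℝ), (∀ T, lam T ∈ Ioc (0 : ℝ) 1) ∧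
    ∀ (X Y Ω : Type*) [MeasurableSpace X] [MeasurableSpace Y] [MeasurableSpace Ω]
      (μ : Measure Ω) [IsProbabilityMeasure μ]
      (d : X → X → ℝ) (A : GraphSSL.LabelingAlgorithm n X Y) (ℓ : Y → Y → ℝ)
      (I : ℕ → Ω → GraphSSL.SSLInstance n X Y),
      (∀ x, d x x = 0) →
      (∀ y y', ℓ y y' ∈ Icc (0 : ℝ) 1) →
      Measurable (Function.uncurry d) →
      Measurable (Function.uncurry ℓ) →
      (∀ w u, Measurable fun J : GraphSSL.SSLInstance n X Y =>
        A w (GraphSSL.points J) (GraphSSL.visibleLabels J) u) →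
      (∀ t, Measurable (I t)) →
      -- the losses, as random functions of the threshold, are independent
      iIndepFun (fun (t : ℕ) (ω : Ω) (r : ℝ) => GraphSSL.loss d A ℓ (I t ω) r) μ →
      -- each distance between two different nodes has a `κ`-bounded distribution
      (∀ t, ∀ i j : Fin n, i ≠ j → GraphSSL.KBounded κ
        (μ.map fun ω => d (GraphSSL.points (I t ω) i) (GraphSSL.points (I t ω) j))) →
      -- the losses are piecewise constant with breakpoints at distances between nodes
      (∀ t ω,
        GraphSSL.PiecewiseConstantOn (GraphSSL.loss d A ℓ (I t ω)) univ
          {r | ∃ i j, r = d (GraphSSL.points (I t ω) i) (GraphSSL.points (I t ω) j)} ∧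
        GraphSSL.PiecewiseConstantOn (GraphSSL.loss d A ℓ (I t ω)) (Ici 0)
          {r | ∃ i j, i ≠ j ∧
            r = d (GraphSSL.points (I t ω) i) (GraphSSL.points (I t ω) j)}) ∧
      -- the total and the average losses are `1/2`-dispersed on `[0, ∞)`
      (∀ L : ℝ, 0 ≤ L →
        GraphSSL.DispersedWith μ (fun t ω => GraphSSL.loss d A ℓ (I t ω)) (Ici 0)
          (1 / 2) L K q ∧
        GraphSSL.DispersedWith μ (fun t ω => GraphSSL.avgLoss d A ℓ (I t ω)) (Ici 0)
          (1 / 2) L K q) ∧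
      -- regret in terms of the average losses
      (∀ T : ℕ, 1 ≤ T →
        GraphSSL.ExpectedRegretLE μ (Icc a b) (lam T)
          (fun t ω => GraphSSL.avgLoss d A ℓ (I t ω))
          (fun t ω => GraphSSL.avgLoss d A ℓ (I t ω)) T
          (K' * Real.sqrt T * (1 + Real.log T) ^ q')) ∧
      -- regret in terms of the total losses, when all instances have equally many unlabeled nodes
      (∀ m : ℕ, (∀ t ω, (GraphSSL.unlabeled (I t ω)).card = m) → ∀ T : ℕ, 1 ≤ T →
        GraphSSL.ExpectedRegretLE μ (Icc a b) (lam T)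
          (fun t ω => GraphSSL.avgLoss d A ℓ (I t ω))
          (fun t ω => GraphSSL.loss d A ℓ (I t ω)) T
          (K' * Real.sqrt T * (1 + Real.log T) ^ q')) := by
  refine ⟨4 * n ^ 2 * κ + 1 + 8 * n ^ 2, 1, fun a b ha hab => ?_⟩
  set K : ℝ := 4 * n ^ 2 * κ + 1 + 8 * n ^ 2
  have hK : 0 ≤ K := by positivity
  set B : ℝ := K + Real.log (max 1 (b - a)) + 1
  have hB : 0 ≤ B := by
    have := Real.log_nonneg (le_max_left 1 (b - a))
    positivity
  -- The factor `n + 1` covers both the average losses (factor `1`) and the total losses (factor `m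
  -- ≤ n`). The `max` keeps the step size in `(0, 1]` at `T = 0`.
  refine ⟨(n + 1) * B, 2, fun T => 1 / √(max 1 (T : ℝ)), fun T => ?_, ?_⟩
  · have h : 1 ≤ √(max 1 (T : ℝ)) := Real.one_le_sqrt.2 (le_max_left _ _)
    exact ⟨by positivity, div_le_one_of_le₀ h (by positivity)⟩
  intro X Y Ω _ _ _ μ _ d A ℓ I hd0 hℓ01 hd hℓ hA hI hind hκ
  have hdisp : ∀ L : ℝ, 0 ≤ L →
      GraphSSL.DispersedWith μ (fun t ω => GraphSSL.avgLoss d A ℓ (I t ω)) (Ici 0)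
        (1 / 2) L K 1 := fun L hL =>
    GraphSSL.dispersedWith_of_loss hd0 hd hℓ hA hI hind hκ
      (fun t ω ρ ρ' h => by simp only [GraphSSL.avgLoss, h]) hL
  have hreg : ∀ T : ℕ, 1 ≤ T →
      GraphSSL.ExpectedRegretLE μ (Icc a b) (1 / √(max 1 (T : ℝ)))
        (fun t ω => GraphSSL.avgLoss d A ℓ (I t ω))
        (fun t ω => GraphSSL.avgLoss d A ℓ (I t ω)) T
        (B * √T * (1 + Real.log T) ^ 2) := by
    intro T hT
    rw [max_eq_right (by exact_mod_cast hT)]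
    refine GraphSSL.expectedRegretLE_of_dispersedWith ha hab hK
      (fun t ω r => GraphSSL.avgLoss_mem_Icc d A hℓ01 (I t ω) r) (fun t => ?_)
      (fun t ω r hr => ?_) (hdisp 0 le_rfl) hT
    · exact (GraphSSL.measurable_avgLoss hd hℓ hA).comp
        (((hI t).comp measurable_fst).prodMk measurable_snd)
    · filter_upwards [(GraphSSL.loss_piecewiseConstantOn_Ici hd0 A ℓ (I t ω)).eventually_eq hr]
        with r' hr'
      simp only [GraphSSL.avgLoss, hr']
  have hmono : ∀ (T k : ℕ), 1 ≤ T → k ≤ n + 1 → (k : ℝ) * (B * √T * (1 + Real.log T) ^ 2) ≤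
      (n + 1) * B * √T * (1 + Real.log T) ^ 2 := by
    intro T k hT hk
    have hk' : (k : ℝ) ≤ n + 1 := by exact_mod_cast hk
    rw [mul_assoc, mul_assoc, mul_assoc]
    exact mul_le_mul_of_nonneg_right hk' (by positivity)
  refine ⟨fun t ω => ⟨GraphSSL.loss_piecewiseConstantOn_univ d A ℓ (I t ω),
    GraphSSL.loss_piecewiseConstantOn_Ici hd0 A ℓ (I t ω)⟩, fun L hL => ⟨?_, hdisp L hL⟩,
    fun T hT => (hreg T hT).mono ?_, fun m hm T hT => ?_⟩
  · exact GraphSSL.dispersedWith_of_loss hd0 hd hℓ hA hI hind hκ (fun t ω ρ ρ' h => h) hL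
  · simpa using hmono T 1 hT (by omega)
  · have hloss : (fun t ω => GraphSSL.loss d A ℓ (I t ω)) =
        fun t ω r => (m : ℝ) * GraphSSL.avgLoss d A ℓ (I t ω) r := by
      funext t ω r
      rw [GraphSSL.loss_eq_card_mul_avgLoss, hm t ω]
    rw [hloss]
    by_cases hmn : m ≤ n + 1
    · exact ((hreg T hT).const_mul (Nat.cast_nonneg m)).mono (hmono T m hT hmn)
    · exfalso
      -- A sample point exists because `μ` is a probability measure; its instance has at most `n`
      -- unlabeled nodes, so `m ≤ n`.
      obtain ⟨ω⟩ : Nonempty Ω := μ.nonempty_of_neZero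
      have h := (Finset.card_le_univ (GraphSSL.unlabeled (I 0 ω))).trans_eq (Fintype.card_fin n)
      rw [hm 0 ω] at h
      omega
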